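/- **Proposition (phase-space area change).** Let $L>0$, $\kappa\ge 1$, $T_s>0$, and set $d=\frac{1}{\sqrt\kappa+1}$, $\beta=\frac{\sqrt\kappa-1}{\sqrt\kappa+1}$. Let $f:\mathbb{R}^n\to\mathbb{R}$ be twice continuously differentiable, with gradient $\nabla f$ and Hessian $\Delta f$. Put $T(p)=\tfrac12|p|^2$, $$f_{\mathrm{NP}}(q,p)=-2dp-\tfrac1L\big(\nabla f(q+\beta p)-\nabla f(q)\big),$$ and let $\psi:(q,p)\mapsto(q^+,p^+)$ on $\mathbb{R}^{2n}$ be one step of the semi-implicit Euler scheme $$p^+=p+T_s\big(-\tfrac1L\nabla f(q)+f_{\mathrm{NP}}(q,p)\big),\qquad q^+=q+T_s\nabla T(p^+).$$ (i) Let $n=1$ and let $\partial\Gamma$ be a simple closed contour (continuous and piecewise $C^1$) in the $(q,p)$-plane. For a closed contour $c$ with enclosed region $\Gamma_c$ (the union of the bounded components of its complement), let $\int_{\Gamma_c} g\,dq\wedge dp$ denote the integral of $g$ over $\Gamma_c$ with respect to area, each point being weighted by the winding number of $c$ around it; for a simple contour the weight is $+1$ if $c$ is counter-clockwise and $-1$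 if it is clockwise. Let $A(c)=\int_{\Gamma_c}dq\wedge dp$ be the signed enclosed area. Then, with $\Gamma$ the region enclosed by $\partial\Gamma$, $$A(\psi\circ\partial\Gamma)-A(\partial\Gamma)=-T_s\oint_{\partial\Gamma}f_{\mathrm{NP}}(q,p)\,dq=-T_s\int_{\Gamma}\Big(2d+\tfrac{\beta}{L}f''(q+\beta p)\Big)\,dq\wedge dp .$$ (ii) Let $n$ be arbitrary, let $S\subset\mathbb{R}^2$ be the closed unit simplex, and let $\Gamma$ be a two-dimensional surface with boundary in $\mathbb{R}^{2n}$, parametrized on $S$ by a $C^2$ map $\Phi:\mathbb{R}^2\to\mathbb{R}^{2n}$; integrals over $\Gamma$ are integrals over $S$ of the pull-back by $\Phi$, and $\partial\Gamma$ is the image of the positively oriented boundary of $S$. Let $A(\Gamma)=\int_\Gamma\sum_i dq_i\wedge dp_i$ be the signed symplectic area, and let $\psi(\Gamma)$ be the surface parametrized by $\psi\circ\Phi$. Then $$A(\psi(\Gamma))-A(\Gamma)=-T_s\int_{\partial\Gamma}f_{\mathrm{NP}}(q,p)\cdot dq=-T_s\int_\Gamma\sum_{i,j}\Big(2d\,\delta_{ij}+\tfrac{\beta}{L}\,(\Delta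 f(q+\beta p))_{ij}\Big)\,dq_i\wedge dp_j .$$ -/

import Mathlib

open Set MeasureTheory

noncomputable section

/-! ### The discretized dynamics -/

/-- The damping constant `d = 1 / (√κ + 1)` (time scale `γ = 1`). -/
def dampingD (κ : ℝ) : ℝ := 1 / (Real.sqrt κ + 1)

/-- The constant `β = (√κ - 1) / (√κ + 1)` (time scale `γ = 1`). -/
def dampingBeta (κ : ℝ) : ℝ := (Real.sqrt κ - 1) / (Real.sqrt κ + 1)

/-- The kinetic energy `T(p) = |p|² / 2`. -/
def kineticEnergy {V : Type*} [NormedAddCommGroup V] (p : V) : ℝ := (1 / 2) * ‖p‖ ^ 2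

/-- The non-potential force
`f_NP(q, p) = - 2 d p - (1 / L) (∇f(q + β p) - ∇f(q))` at the phase-space point `x = (q, p)`. -/
def forceNP {V : Type*} [NormedAddCommGroup V] [InnerProductSpace ℝ V] [CompleteSpace V]
    (f : V → ℝ) (L κ : ℝ) (x : V × V) : V :=
  -((2 * dampingD κ) • x.2)
    - (1 / L) • (gradient f (x.1 + dampingBeta κ • x.2) - gradient f x.1)

/-- The momentum update `p⁺ = p + T_s (- (1 / L) ∇f(q) + f_NP(q, p))`. -/
def nextMomentum {V : Type*} [NormedAddCommGroup V] [InnerProductSpace ℝ V] [CompleteSpace V]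
    (f : V → ℝ) (L κ Ts : ℝ) (x : V × V) : V :=
  x.2 + Ts • (-((1 / L) • gradient f x.1) + forceNP f L κ x)

/-- One step `ψ : (q, p) ↦ (q⁺, p⁺)` of the semi-implicit Euler scheme, with
`q⁺ = q + T_s ∇T(p⁺)`. -/
def eulerStep {V : Type*} [NormedAddCommGroup V] [InnerProductSpace ℝ V] [CompleteSpace V]
    (f : V → ℝ) (L κ Ts : ℝ) (x : V × V) : V × V :=
  (x.1 + Ts • gradient (kineticEnergy (V := V)) (nextMomentum f L κ Ts x),
    nextMomentum f L κ Ts x)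

/-! ### Line integrals -/

/-- The line integral `∫_c F(q, p) dq = ∫₀¹ ⟨F(c(s)), dq/ds⟩ ds` along a parametrized curve
`c = (q, p)` on `[0, 1]`. -/
def lineIntegralDq {V : Type*} [NormedAddCommGroup V] [InnerProductSpace ℝ V]
    (F : V × V → V) (c : ℝ → V × V) : ℝ :=
  ∫ s in (0 : ℝ)..1, inner ℝ (F (c s)) (deriv (fun t => (c t).1) s)

/-! ### Smooth two-dimensional surfaces in phase space -/

/-- The closed unit simplex of `ℝ²`. -/
def unitSimplex : Set (ℝ × ℝ) := {u | 0 ≤ u.1 ∧ 0 ≤ u.2 ∧ u.1 + u.2 ≤ 1}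

/-- The two-form `∑ i j, M i j dq_i ∧ dp_j` evaluated on the tangent vectors `u`, `v`.
For `M` the identity this is the canonical symplectic form `dq ∧ dp = ∑ i, dq_i ∧ dp_i`. -/
def wedgeForm {V : Type*} [NormedAddCommGroup V] [InnerProductSpace ℝ V]
    (M : V →L[ℝ] V) (u v : V × V) : ℝ :=
  inner ℝ u.1 (M v.2) - inner ℝ v.1 (M u.2)

/-- The integral of the two-form `∑ i j, M(q, p) i j dq_i ∧ dp_j` over the surface
parametrized by `Φ` on the unit simplex (the integral of the pull-back). -/
def surfaceIntegral {V : Type*} [NormedAddCommGroup V] [InnerProductSpace ℝ V]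
    (M : V × V → V →L[ℝ] V) (Φ : ℝ × ℝ → V × V) : ℝ :=
  ∫ u in unitSimplex,
    wedgeForm (M (Φ u)) (fderiv ℝ Φ u ((1 : ℝ), (0 : ℝ))) (fderiv ℝ Φ u ((0 : ℝ), (1 : ℝ)))

/-- The signed symplectic area `∫_Γ dq ∧ dp` of the surface parametrized by `Φ`. -/
def surfaceArea {V : Type*} [NormedAddCommGroup V] [InnerProductSpace ℝ V]
    (Φ : ℝ × ℝ → V × V) : ℝ :=
  surfaceIntegral (fun _ => ContinuousLinearMap.id ℝ V) Φ

/-- The line integral `∫_{∂Γ} F(q, p) dq` over the boundary of the surface parametrized by `Φ`: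
the sum over the images of the three oriented edges `0 → e₁ → e₂ → 0` of the unit simplex. -/
def boundaryIntegralDq {V : Type*} [NormedAddCommGroup V] [InnerProductSpace ℝ V]
    (F : V × V → V) (Φ : ℝ × ℝ → V × V) : ℝ :=
  lineIntegralDq F (fun s => Φ (s, 0))
    + lineIntegralDq F (fun s => Φ (1 - s, s))
    + lineIntegralDq F (fun s => Φ (0, 1 - s))

/-- The Hessian of `f`, as the derivative of the gradient. -/
def hessianMap {V : Type*} [NormedAddCommGroup V] [InnerProductSpace ℝ V] [CompleteSpace V]
    (f : V → ℝ) (x : V) : V →L[ℝ] V :=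
  fderiv ℝ (gradient f) x

/-- The curvature-dependent damping `2 d I + (β / L) Δf(q + β p)`. -/
def dampingMap {V : Type*} [NormedAddCommGroup V] [InnerProductSpace ℝ V] [CompleteSpace V]
    (f : V → ℝ) (L κ : ℝ) (x : V × V) : V →L[ℝ] V :=
  (2 * dampingD κ) • ContinuousLinearMap.id ℝ V
    + (dampingBeta κ / L) • hessianMap f (x.1 + dampingBeta κ • x.2)

/-! ### Closed contours in the plane -/

/-- A simple closed contour in the `(q, p)`-plane: a closed curve without self-intersections,
parametrized on `[0, 1]`, continuous and piecewise continuously differentiable (`S` is the finite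
set of corners). -/
structure IsSimpleClosedContour (c : ℝ → ℝ × ℝ) : Prop where
  continuousOn : ContinuousOn c (Icc 0 1)
  closed : c 0 = c 1
  simple : InjOn c (Ico 0 1)
  piecewise : ∃ S : Finset ℝ, ∀ a b : ℝ, 0 ≤ a → a < b → b ≤ 1 →
    Disjoint (Ioo a b) (S : Set ℝ) → ContDiffOn ℝ 1 c (Icc a b)

/-- The region enclosed by a contour: the union of the bounded connected components of its
complement. -/
def enclosedRegion (c : ℝ → ℝ × ℝ) : Set (ℝ × ℝ) :=
  {z | z ∈ (c '' Icc 0 1)ᶜ ∧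
    Bornology.IsBounded (connectedComponentIn (c '' Icc 0 1)ᶜ z)}

/-- The winding number of the contour around `z = (z₁, z₂)`,
`(1 / 2π) ∮ ((q - z₁) dp - (p - z₂) dq) / ((q - z₁)² + (p - z₂)²)`. -/
def windingNumber (c : ℝ → ℝ × ℝ) (z : ℝ × ℝ) : ℝ :=
  (1 / (2 * Real.pi)) * ∫ s in (0 : ℝ)..1,
    (((c s).1 - z.1) * deriv (fun t => (c t).2) s - ((c s).2 - z.2) * deriv (fun t => (c t).1) s)
      / (((c s).1 - z.1) ^ 2 + ((c s).2 - z.2) ^ 2)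

/-- The integral `∫_Γ g(q, p) dq ∧ dp` over the region `Γ` enclosed by a closed contour, where the
sign of `dq ∧ dp = ± dq dp` is inferred from the contour: an enclosed point is counted with the
number of counter-clockwise turns of the contour around it. For a simple contour this number is
`1` at all enclosed points (counter-clockwise) or `-1` at all enclosed points (clockwise); see
`signedIntegral_of_counterclockwise` and `signedIntegral_of_clockwise`. The image of a simple
contour under one step need not be simple, and may be traversed in the other direction. -/
def signedIntegral (c : ℝ → ℝ × ℝ) (g : ℝ × ℝ → ℝ) : ℝ :=
  ∫ z in enclosedRegion c, windingNumber c z * g z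

/-- The signed area `∫_Γ dq ∧ dp` enclosed by a closed contour. -/
def signedArea (c : ℝ → ℝ × ℝ) : ℝ := signedIntegral c (fun _ => 1)

def IsCounterclockwise (c : ℝ → ℝ × ℝ) : Prop := ∀ z ∈ enclosedRegion c, windingNumber c z = 1

def IsClockwise (c : ℝ → ℝ × ℝ) : Prop := ∀ z ∈ enclosedRegion c, windingNumber c z = -1

theorem isOpen_enclosedRegion {c : ℝ → ℝ × ℝ} (hc : ContinuousOn c (Icc 0 1)) :
    IsOpen (enclosedRegion c) := by
  have ho : IsOpen (c '' Icc 0 1)ᶜ := (isCompact_Icc.image_of_continuousOn hc).isClosed.isOpen_compl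
  rw [isOpen_iff_mem_nhds]
  rintro z ⟨hz, hb⟩
  refine Filter.mem_of_superset (ho.connectedComponentIn.mem_nhds (mem_connectedComponentIn hz)) ?_
  intro w hw
  refine ⟨connectedComponentIn_subset _ _ hw, ?_⟩
  rwa [← connectedComponentIn_eq hw]

theorem signedIntegral_of_counterclockwise {c : ℝ → ℝ × ℝ} (hc : ContinuousOn c (Icc 0 1))
    (h : IsCounterclockwise c) (g : ℝ × ℝ → ℝ) :
    signedIntegral c g = ∫ z in enclosedRegion c, g z := by
  refine setIntegral_congr_fun (isOpen_enclosedRegion hc).measurableSet ?_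
  intro z hz
  simp [h z hz]

theorem signedIntegral_of_clockwise {c : ℝ → ℝ × ℝ} (hc : ContinuousOn c (Icc 0 1))
    (h : IsClockwise c) (g : ℝ × ℝ → ℝ) :
    signedIntegral c g = -∫ z in enclosedRegion c, g z := by
  rw [← integral_neg]
  refine setIntegral_congr_fun (isOpen_enclosedRegion hc).measurableSet ?_
  intro z hz
  simp [h z hz]

end

/-! Plane contours. The enclosed area is `-∮ p dq`. Since `q⁺ = q + Ts p⁺` and `p⁺ = p - (Ts/L)
∇f(q) + Ts f_NP`, the form `p⁺ dq⁺ - p dq - Ts f_NP dq` is the differential of `(Ts/2) (p⁺)² -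
(Ts/L) f(q)`, so its loop integral vanishes. This is the first equality
(`IsPiecewiseLoop.signedArea_eulerStep_comp`); the second is Green's formula for `f_NP dq`.

The image contour may cross itself, so Green's formula `∫ w ∂F/∂p = -∮ F dq`, with `w` the winding
number, is needed for arbitrary piecewise `C¹` loops (`IsPiecewiseLoop.signedIntegral_fderiv`). No
Jordan curve theorem enters. The winding number is a loop integral of the kernel `K(x) = x/|x|²`,
whose divergence is `2π` times the Dirac mass at `0`. For compactly supported `F`, Fubini turns `2π
∫ w ∂F/∂p` into `∮ (K₁ * ∂₂F) dp - (K₂ * ∂₂F) dq`. By `K₁ * ∂₁F + K₂ * ∂₂F = 2πF` this form plus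
`2πF dq` is `d(K₁ * F)`, hence exact. A cut-off removes the support assumption, because `w` vanishes
on unbounded components of the complement.

Surfaces. Pointwise, `ψ` pulls `dq ∧ dp` back to `dq ∧ dp - Ts d(f_NP · dq)`
(`wedgeForm_fderiv_eulerStep`): `dp⁺ ∧ dp⁺` and the terms in the Hessian at `q` drop out by
symmetry. Stokes is then applied only to `f_NP · dq` on `Φ`, not to `ψ ∘ Φ`, which is merely `C¹`.
-/

noncomputable section

/-! ### The Cauchy kernel of the plane -/

/-- The first component of the kernel `x / |x|²`. -/
def kernelFst (x : ℝ × ℝ) : ℝ := x.1 / (x.1 ^ 2 + x.2 ^ 2)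

/-- The second component of the kernel `x / |x|²`. -/
def kernelSnd (x : ℝ × ℝ) : ℝ := x.2 / (x.1 ^ 2 + x.2 ^ 2)

theorem measurable_kernelFst : Measurable kernelFst := by
  unfold kernelFst; fun_prop

theorem measurable_kernelSnd : Measurable kernelSnd := by
  unfold kernelSnd; fun_prop

theorem norm_sq_le_sq_add_sq (x : ℝ × ℝ) : ‖x‖ ^ 2 ≤ x.1 ^ 2 + x.2 ^ 2 := by
  rw [Prod.norm_def]
  rcases max_cases ‖x.1‖ ‖x.2‖ with ⟨h, _⟩ | ⟨h, _⟩ <;> rw [h, Real.norm_eq_abs, sq_abs] <;>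
    nlinarith [sq_nonneg x.1, sq_nonneg x.2]

theorem abs_div_sq_add_sq_le {a : ℝ} {x : ℝ × ℝ} (ha : |a| ≤ ‖x‖) :
    |a / (x.1 ^ 2 + x.2 ^ 2)| ≤ ‖x‖⁻¹ := by
  have h := norm_sq_le_sq_add_sq x
  rcases (norm_nonneg x).eq_or_lt' with h0 | h0
  · have : a = 0 := abs_nonpos_iff.1 (h0 ▸ ha)
    simp [this]
  · rw [abs_div, abs_of_nonneg (by positivity : 0 ≤ x.1 ^ 2 + x.2 ^ 2), inv_eq_one_div,
      div_le_div_iff₀ (lt_of_lt_of_le (by positivity) h) h0]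
    nlinarith

theorem abs_kernelFst_le (x : ℝ × ℝ) : |kernelFst x| ≤ ‖x‖⁻¹ :=
  abs_div_sq_add_sq_le (norm_fst_le x)

theorem abs_kernelSnd_le (x : ℝ × ℝ) : |kernelSnd x| ≤ ‖x‖⁻¹ :=
  abs_div_sq_add_sq_le (norm_snd_le x)

/-- The singularity has exponent `1`, below the dimension `2` of the plane. -/
theorem locallyIntegrable_of_abs_le_norm_inv {K : ℝ × ℝ → ℝ} (hK : Measurable K)
    (h : ∀ x, |K x| ≤ ‖x‖⁻¹) : LocallyIntegrable K := by
  refine locallyIntegrable_of_norm_le_rpow (C := 1) (α := 1) ?_ ?_ ?_ hK.aestronglyMeasurable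
  · simp
  · simp
  · filter_upwards with x
    simpa [Real.rpow_neg_one] using h x

theorem locallyIntegrable_kernelFst : LocallyIntegrable kernelFst :=
  locallyIntegrable_of_abs_le_norm_inv measurable_kernelFst abs_kernelFst_le

theorem locallyIntegrable_kernelSnd : LocallyIntegrable kernelSnd :=
  locallyIntegrable_of_abs_le_norm_inv measurable_kernelSnd abs_kernelSnd_le

/-! ### Potentials -/

theorem integrable_smul_comp_sub {E : Type*} [NormedAddCommGroup E] [NormedSpace ℝ E]
    {K : ℝ × ℝ → ℝ} (hK : LocallyIntegrable K) {G : ℝ × ℝ → E}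
    (hG : Continuous G) (hGc : HasCompactSupport G) (y : ℝ × ℝ) :
    Integrable (fun t => K t • G (y - t)) :=
  hGc.convolutionExists_right (ContinuousLinearMap.lsmul ℝ ℝ) hK hG y

/-- In a convolution the derivative can be put on the smooth factor, so the singular kernel need
only be locally integrable. -/
theorem hasFDerivAt_integral_mul_comp_sub {K : ℝ × ℝ → ℝ} (hK : LocallyIntegrable K)
    {F : ℝ × ℝ → ℝ} (hF : ContDiff ℝ 1 F) (hFc : HasCompactSupport F) (y : ℝ × ℝ) :
    HasFDerivAt (fun y => ∫ t, K t * F (y - t)) (∫ t, K t • fderiv ℝ F (y - t)) y :=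
  hFc.hasFDerivAt_convolution_right (ContinuousLinearMap.lsmul ℝ ℝ) hK hF y

theorem integral_smul_fderiv_apply {K : ℝ × ℝ → ℝ} (hK : LocallyIntegrable K)
    {F : ℝ × ℝ → ℝ} (hF : ContDiff ℝ 1 F) (hFc : HasCompactSupport F) (y v : ℝ × ℝ) :
    (∫ t, K t • fderiv ℝ F (y - t)) v = ∫ t, K t * fderiv ℝ F (y - t) v :=
  ContinuousLinearMap.integral_apply
    (integrable_smul_comp_sub hK (hF.continuous_fderiv one_ne_zero) (hFc.fderiv ℝ) y) v

/-- The radial derivative along a ray integrates to minus the value at the origin. -/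
theorem integral_fderiv_ray {F : ℝ × ℝ → ℝ} (hF : ContDiff ℝ 1 F) (hFc : HasCompactSupport F)
    {v : ℝ × ℝ} (hv : v ≠ 0) :
    ∫ r in Ioi (0 : ℝ), fderiv ℝ F (r • v) v = -F 0 := by
  have hd : deriv (fun r : ℝ => F (r • v)) = fun r => fderiv ℝ F (r • v) v := by
    funext r
    have h1 : HasDerivAt (fun r : ℝ => r • v) v r := by
      simpa using (hasDerivAt_id r).smul_const v
    exact ((hF.differentiable one_ne_zero (r • v)).hasFDerivAt.comp_hasDerivAt r h1).deriv
  have hc : HasCompactSupport (fun r : ℝ => F (r • v)) :=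
    hFc.comp_isClosedEmbedding (isClosedEmbedding_smul_left hv)
  have hs : ContDiff ℝ 1 (fun r : ℝ => F (r • v)) :=
    hF.comp (contDiff_id.smul contDiff_const)
  have := hc.integral_Ioi_deriv_eq hs 0
  rw [hd] at this
  simpa using this

/-- In polar coordinates the integrand is the radial derivative of `F` divided by `r`. The Jacobian
cancels the `1/r`, each ray contributes `-F 0`, and the angles contribute `2π`. -/
theorem integral_kernel_fderiv {F : ℝ × ℝ → ℝ} (hF : ContDiff ℝ 1 F)
    (hFc : HasCompactSupport F) :
    ∫ x, (kernelFst x * fderiv ℝ F x (1, 0) + kernelSnd x * fderiv ℝ F x (0, 1))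
      = -(2 * Real.pi) * F 0 := by
  set v : ℝ → ℝ × ℝ := fun θ => (Real.cos θ, Real.sin θ) with hv
  have hvc : Continuous v := by fun_prop
  have hv0 : ∀ θ, v θ ≠ 0 := fun θ h => by
    have h1 : Real.cos θ = 0 := congrArg Prod.fst h
    have h2 : Real.sin θ = 0 := congrArg Prod.snd h
    have := Real.sin_sq_add_cos_sq θ
    simp [h1, h2] at this
  have hpolar : ∀ p ∈ polarCoord.target,
      p.1 • (kernelFst (polarCoord.symm p) * fderiv ℝ F (polarCoord.symm p) (1, 0)
        + kernelSnd (polarCoord.symm p) * fderiv ℝ F (polarCoord.symm p) (0, 1))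
      = fderiv ℝ F (p.1 • v p.2) (v p.2) := by
    rintro ⟨r, θ⟩ ⟨hr, -⟩
    have hr : 0 < r := hr
    have hp : polarCoord.symm (r, θ) = r • v θ := by simp [hv]
    rw [hp]
    have h1 : (r * Real.cos θ) ^ 2 + (r * Real.sin θ) ^ 2 = r ^ 2 := by
      linear_combination r ^ 2 * Real.sin_sq_add_cos_sq θ
    have h2 : v θ = Real.cos θ • ((1 : ℝ), (0 : ℝ)) + Real.sin θ • ((0 : ℝ), (1 : ℝ)) := by
      simp [hv]
    have h3 : fderiv ℝ F (r • v θ) (v θ) = Real.cos θ * fderiv ℝ F (r • v θ) (1, 0)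
        + Real.sin θ * fderiv ℝ F (r • v θ) (0, 1) := by
      conv_lhs => enter [2]; rw [h2]
      rw [map_add, map_smul, map_smul, smul_eq_mul, smul_eq_mul]
    simp only [h3, kernelFst, kernelSnd]
    simp only [hv, Prod.smul_mk, smul_eq_mul, h1]
    field_simp
  rw [← integral_comp_polarCoord_symm,
    setIntegral_congr_fun polarCoord.open_target.measurableSet hpolar, polarCoord_target]
  have hG : Continuous (fun p : ℝ × ℝ => fderiv ℝ F (p.1 • v p.2) (v p.2)) :=
    ((hF.continuous_fderiv one_ne_zero).comp (by fun_prop)).clm_apply (by fun_prop)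
  obtain ⟨R, hR⟩ : ∃ R : ℝ, ∀ x, R < ‖x‖ → fderiv ℝ F x = 0 := by
    obtain ⟨R, hR⟩ := (hFc.fderiv ℝ).isCompact.isBounded.exists_norm_le
    exact ⟨R, fun x hx => by
      by_contra h
      exact absurd (hR x (subset_tsupport _ h)) (not_le.2 hx)⟩
  -- The norm on `ℝ × ℝ` is the sup norm, so `v θ` need not have norm one. The bound `1/2` suffices:
  -- for `r > 2R` the point `r • v θ` is outside the support.
  have hnv : ∀ θ, (1 : ℝ) ≤ 2 * ‖v θ‖ := fun θ => by
    have h1 : |Real.cos θ| ≤ ‖v θ‖ := norm_fst_le (v θ)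
    have h2 : |Real.sin θ| ≤ ‖v θ‖ := norm_snd_le (v θ)
    nlinarith [Real.sin_sq_add_cos_sq θ, sq_abs (Real.cos θ), sq_abs (Real.sin θ),
      abs_nonneg (Real.cos θ), abs_nonneg (Real.sin θ), norm_nonneg (v θ)]
  have hI : IntegrableOn (fun p : ℝ × ℝ => fderiv ℝ F (p.1 • v p.2) (v p.2))
      (Ioi 0 ×ˢ Ioo (-Real.pi) Real.pi) (volume.prod volume) := by
    have h1 : IntegrableOn (fun p : ℝ × ℝ => fderiv ℝ F (p.1 • v p.2) (v p.2))
        (Icc 0 (2 * R) ×ˢ Icc (-Real.pi) Real.pi) (volume.prod volume) :=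
      hG.continuousOn.integrableOn_compact (isCompact_Icc.prod isCompact_Icc)
    refine h1.of_forall_sdiff_eq_zero (measurableSet_Ioi.prod measurableSet_Ioo) ?_
    rintro ⟨r, θ⟩ ⟨⟨hr, hθ⟩, hn⟩
    have hr : 0 < r := hr
    have : 2 * R < r := by
      by_contra h
      exact hn ⟨⟨hr.le, not_lt.1 h⟩, Ioo_subset_Icc_self hθ⟩
    rw [show fderiv ℝ F (r • v θ) = 0 from hR _ ?_]
    · simp
    · rw [norm_smul, Real.norm_of_nonneg hr.le]
      nlinarith [hnv θ]
  rw [IntegrableOn, ← Measure.prod_restrict] at hI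
  rw [Measure.volume_eq_prod, ← Measure.prod_restrict, integral_prod_symm _ hI]
  simp only [integral_fderiv_ray hF hFc (hv0 _)]
  rw [setIntegral_const]
  simp [Measure.real]
  ring_nf
  simp [Real.pi_pos.le]

/-- The weak form of `div K = 2πδ`: the previous identity for the reflected function `t ↦ F (y -
t)`, whose derivative changes sign. -/
theorem integral_kernel_fderiv_sub {F : ℝ × ℝ → ℝ} (hF : ContDiff ℝ 1 F)
    (hFc : HasCompactSupport F) (y : ℝ × ℝ) :
    (∫ t, kernelFst t * fderiv ℝ F (y - t) (1, 0))
      + ∫ t, kernelSnd t * fderiv ℝ F (y - t) (0, 1) = 2 * Real.pi * F y := by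
  have hcd : ∀ v : ℝ × ℝ, Continuous fun x => fderiv ℝ F x v := fun v =>
    (hF.continuous_fderiv one_ne_zero).clm_apply continuous_const
  have hcs : ∀ v : ℝ × ℝ, HasCompactSupport fun x => fderiv ℝ F x v := fun v =>
    hFc.fderiv_apply ℝ v
  have h := integral_kernel_fderiv (F := fun t => F (y - t))
    (hF.comp (contDiff_const.sub contDiff_id))
    (hFc.comp_homeomorph (Homeomorph.subLeft y))
  have hd : ∀ t v, fderiv ℝ (fun t => F (y - t)) t v = -fderiv ℝ F (y - t) v := fun t v => by
    have := (hF.differentiable one_ne_zero (y - t)).hasFDerivAt.comp t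
      ((hasFDerivAt_id t).const_sub y)
    rw [show fderiv ℝ (fun t => F (y - t)) t = _ from this.fderiv]
    simp
  simp only [hd, mul_neg, sub_zero] at h
  have i1 := integrable_smul_comp_sub locallyIntegrable_kernelFst (hcd (1, 0)) (hcs _) y
  have i2 := integrable_smul_comp_sub locallyIntegrable_kernelSnd (hcd (0, 1)) (hcs _) y
  simp only [smul_eq_mul] at i1 i2
  rw [← integral_add i1 i2, ← neg_inj, ← neg_mul, ← h, ← integral_neg]
  simp only [neg_add]

/-! ### Piecewise `C¹` loops -/

/-- A closed curve on `[0, 1]` that is differentiable with bounded derivative off a countable set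
of parameters. -/
structure IsPiecewiseLoop (c : ℝ → ℝ × ℝ) : Prop where
  continuousOn : ContinuousOn c (Icc 0 1)
  closed : c 0 = c 1
  exists_bound : ∃ S : Set ℝ, S.Countable ∧ ∃ C : ℝ, ∀ t ∈ Ioo (0 : ℝ) 1 \ S,
    DifferentiableAt ℝ c t ∧ ‖deriv c t‖ ≤ C

theorem exists_bound_deriv_of_contDiffOn {c : ℝ → ℝ × ℝ} {a b : ℝ} (hab : a < b)
    (h : ContDiffOn ℝ 1 c (Icc a b)) :
    ∃ C : ℝ, ∀ t ∈ Ioo a b, DifferentiableAt ℝ c t ∧ ‖deriv c t‖ ≤ C := by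
  obtain ⟨C, hC⟩ := isCompact_Icc.exists_bound_of_continuousOn
    (h.continuousOn_derivWithin (uniqueDiffOn_Icc hab) le_rfl)
  refine ⟨C, fun t ht => ?_⟩
  have hn : Icc a b ∈ nhds t := Icc_mem_nhds ht.1 ht.2
  refine ⟨(h.differentiableOn one_ne_zero).differentiableAt hn, ?_⟩
  rw [← derivWithin_of_mem_nhds hn]
  exact hC t (Ioo_subset_Icc_self ht)

/-- By compactness of `[0, 1]` it suffices to work near one parameter `x`. A small neighbourhood
contains no corner except possibly `x`, and on either side the curve is `C¹` up to the endpoints, so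
its derivative is bounded there. -/
theorem IsSimpleClosedContour.isPiecewiseLoop {c : ℝ → ℝ × ℝ} (hc : IsSimpleClosedContour c) :
    IsPiecewiseLoop c := by
  obtain ⟨S, hS⟩ := hc.piecewise
  refine ⟨hc.continuousOn, hc.closed, ?_⟩
  suffices h : ∃ T : Set ℝ, T.Countable ∧ ∃ C : ℝ, ∀ t ∈ (Icc 0 1 ∩ Ioo (0 : ℝ) 1) \ T,
      DifferentiableAt ℝ c t ∧ ‖deriv c t‖ ≤ C by
    rwa [inter_eq_right.2 Ioo_subset_Icc_self] at h
  have key : ∀ x ∈ Icc (0 : ℝ) 1, ∃ u ∈ nhdsWithin x (Icc 0 1), 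
      ∃ T : Set ℝ, T.Countable ∧ ∃ C : ℝ, ∀ t ∈ (u ∩ Ioo (0 : ℝ) 1) \ T,
         DifferentiableAt ℝ c t ∧ ‖deriv c t‖ ≤ C := by
    intro x hx
    have hf : ((S : Set ℝ) \ {x})ᶜ ∈ nhds x :=
      (S.finite_toSet.sdiff).isClosed.isOpen_compl.mem_nhds (by simp)
    obtain ⟨ε, hε, hball⟩ := Metric.mem_nhds_iff.1 hf
    have hdisj : ∀ t, t ∈ (S : Set ℝ) → |t - x| < ε → t = x := fun t ht hd => by
      by_contra hne
      exact hball (by simpa [Real.dist_eq] using hd) ⟨ht, hne⟩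
    have hleft : ∃ C : ℝ, ∀ t ∈ Ioo (max 0 (x - ε)) x,
        DifferentiableAt ℝ c t ∧ ‖deriv c t‖ ≤ C := by
      rcases lt_or_ge (max 0 (x - ε)) x with h | h
      · refine exists_bound_deriv_of_contDiffOn h (hS _ _ (le_max_left _ _) h hx.2 ?_)
        rw [Set.disjoint_left]
        intro t ht hts
        have h1 := (le_max_right 0 (x - ε)).trans_lt ht.1
        exact ht.2.ne (hdisj t hts (abs_lt.2 ⟨by linarith, by linarith [ht.2]⟩))
      · exact ⟨0, fun t ht => by simp [Ioo_eq_empty (not_lt.2 h)] at ht⟩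
    have hright : ∃ C : ℝ, ∀ t ∈ Ioo x (min 1 (x + ε)),
        DifferentiableAt ℝ c t ∧ ‖deriv c t‖ ≤ C := by
      rcases lt_or_ge x (min 1 (x + ε)) with h | h
      · refine exists_bound_deriv_of_contDiffOn h (hS _ _ hx.1 h (min_le_left _ _) ?_)
        rw [Set.disjoint_left]
        intro t ht hts
        have h1 := ht.2.trans_le (min_le_right 1 (x + ε))
        exact ht.1.ne' (hdisj t hts (abs_lt.2 ⟨by linarith [ht.1], by linarith⟩))
      · exact ⟨0, fun t ht => by simp [Ioo_eq_empty (not_lt.2 h)] at ht⟩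
    obtain ⟨C₁, h₁⟩ := hleft
    obtain ⟨C₂, h₂⟩ := hright
    refine ⟨Metric.ball x ε, mem_nhdsWithin_of_mem_nhds (Metric.ball_mem_nhds x hε),
      {x}, countable_singleton x, max C₁ C₂, ?_⟩
    rintro t ⟨⟨htb, ht⟩, htS⟩
    rw [Metric.mem_ball, Real.dist_eq, abs_lt] at htb
    rcases lt_trichotomy t x with h | h | h
    · obtain ⟨h3, h4⟩ := h₁ t ⟨max_lt ht.1 (by linarith), h⟩
      exact ⟨h3, h4.trans (le_max_left _ _)⟩
    · exact absurd h htS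
    · obtain ⟨h3, h4⟩ := h₂ t ⟨h, lt_min ht.2 (by linarith)⟩
      exact ⟨h3, h4.trans (le_max_right _ _)⟩
  refine isCompact_Icc.induction_on (p := fun u => ∃ T : Set ℝ, T.Countable ∧ ∃ C : ℝ,
    ∀ t ∈ (u ∩ Ioo (0 : ℝ) 1) \ T, DifferentiableAt ℝ c t ∧ ‖deriv c t‖ ≤ C) ?_ ?_ ?_ key
  · exact ⟨∅, countable_empty, 0, by simp⟩
  · rintro u v huv ⟨T, hT, C, hC⟩
    exact ⟨T, hT, C, fun t ht => hC t ⟨⟨huv ht.1.1, ht.1.2⟩, ht.2⟩⟩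
  · rintro u v ⟨T, hT, C, hC⟩ ⟨T', hT', C', hC'⟩
    refine ⟨T ∪ T', hT.union hT', max C C', ?_⟩
    rintro t ⟨⟨htu | htv, ht⟩, htT⟩
    · obtain ⟨h1, h2⟩ := hC t ⟨⟨htu, ht⟩, fun h => htT (Or.inl h)⟩
      exact ⟨h1, h2.trans (le_max_left _ _)⟩
    · obtain ⟨h1, h2⟩ := hC' t ⟨⟨htv, ht⟩, fun h => htT (Or.inr h)⟩
      exact ⟨h1, h2.trans (le_max_right _ _)⟩

theorem IsPiecewiseLoop.exists_norm_le {c : ℝ → ℝ × ℝ} (hc : IsPiecewiseLoop c) :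
    ∃ R : ℝ, ∀ s ∈ Icc (0 : ℝ) 1, ‖c s‖ ≤ R :=
  isCompact_Icc.exists_bound_of_continuousOn hc.continuousOn

/-- The reason for dropping simplicity: this class of loops is stable under the step `ψ`, whereas
simple contours are not. -/
theorem IsPiecewiseLoop.comp {c : ℝ → ℝ × ℝ} (hc : IsPiecewiseLoop c)
    {g : ℝ × ℝ → ℝ × ℝ} (hg : ContDiff ℝ 1 g) : IsPiecewiseLoop (g ∘ c) := by
  obtain ⟨S, hS, C, hC⟩ := hc.exists_bound
  have hK : IsCompact (c '' Icc 0 1) := isCompact_Icc.image_of_continuousOn hc.continuousOn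
  obtain ⟨D, hD⟩ := hK.exists_bound_of_continuousOn
    (hg.continuous_fderiv one_ne_zero).continuousOn
  refine ⟨hg.continuous.comp_continuousOn hc.continuousOn, by simp [hc.closed], S, hS, D * C,
    fun t ht => ?_⟩
  have h := (hg.differentiable one_ne_zero (c t)).hasFDerivAt.comp_hasDerivAt t
    (hC t ht).1.hasDerivAt
  refine ⟨h.differentiableAt, ?_⟩
  rw [h.deriv]
  have h1 := hD (c t) ⟨t, Ioo_subset_Icc_self ht.1, rfl⟩
  exact (ContinuousLinearMap.le_opNorm _ _).trans
    (mul_le_mul h1 (hC t ht).2 (norm_nonneg _) ((norm_nonneg _).trans h1))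

theorem IsPiecewiseLoop.exists_ae_bound {c : ℝ → ℝ × ℝ} (hc : IsPiecewiseLoop c) :
    ∃ C : ℝ, 0 ≤ C ∧ ∀ᵐ t, t ∈ uIoc (0 : ℝ) 1 → t ∈ Icc (0 : ℝ) 1 ∧ DifferentiableAt ℝ c t ∧
      ‖deriv c t‖ ≤ C := by
  obtain ⟨S, hS, C, hC⟩ := hc.exists_bound
  refine ⟨max C 0, le_max_right _ _, ?_⟩
  have h1 : ∀ᵐ t : ℝ, t ∉ S := hS.ae_notMem _
  -- `uIoc 0 1` contains the endpoint `1`, where differentiability is not assumed.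
  have h2 : ∀ᵐ t : ℝ, t ≠ 1 := by simp [ae_iff]
  filter_upwards [h1, h2] with t ht1 ht2 ht
  rw [uIoc_of_le zero_le_one] at ht
  have := hC t ⟨⟨ht.1, lt_of_le_of_ne ht.2 ht2⟩, ht1⟩
  exact ⟨⟨ht.1.le, ht.2⟩, this.1, this.2.trans (le_max_left _ _)⟩

theorem deriv_fst_of_differentiableAt {V W : Type*} [NormedAddCommGroup V] [NormedSpace ℝ V]
    [NormedAddCommGroup W] [NormedSpace ℝ W] {c : ℝ → V × W} {t : ℝ}
    (h : DifferentiableAt ℝ c t) : deriv (fun t => (c t).1) t = (deriv c t).1 :=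
  ((ContinuousLinearMap.fst ℝ V W).hasFDerivAt.comp_hasDerivAt t h.hasDerivAt).deriv

theorem deriv_snd_of_differentiableAt {V W : Type*} [NormedAddCommGroup V] [NormedSpace ℝ V]
    [NormedAddCommGroup W] [NormedSpace ℝ W] {c : ℝ → V × W} {t : ℝ}
    (h : DifferentiableAt ℝ c t) : deriv (fun t => (c t).2) t = (deriv c t).2 :=
  ((ContinuousLinearMap.snd ℝ V W).hasFDerivAt.comp_hasDerivAt t h.hasDerivAt).deriv

theorem intervalIntegrable_of_ae_bound {E : Type*} [NormedAddCommGroup E] {f : ℝ → E} {C : ℝ}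
    (hf : AEStronglyMeasurable f (volume.restrict (uIoc 0 1)))
    (h : ∀ᵐ t, t ∈ uIoc (0 : ℝ) 1 → ‖f t‖ ≤ C) : IntervalIntegrable f volume 0 1 := by
  rw [intervalIntegrable_iff]
  have : IntegrableOn (fun _ : ℝ => C) (uIoc 0 1) := by simp [uIoc_of_le]
  refine Integrable.mono' this hf ?_
  rwa [ae_restrict_iff' measurableSet_uIoc]

theorem IsPiecewiseLoop.intervalIntegrable_deriv_fst {c : ℝ → ℝ × ℝ} (hc : IsPiecewiseLoop c) :
    IntervalIntegrable (deriv fun t => (c t).1) volume 0 1 := by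
  obtain ⟨C, -, hC⟩ := hc.exists_ae_bound
  refine intervalIntegrable_of_ae_bound (C := C) (measurable_deriv _).aestronglyMeasurable
    (hC.mono fun t h ht => ?_)
  rw [deriv_fst_of_differentiableAt (h ht).2.1]
  exact (norm_fst_le _).trans (h ht).2.2

theorem IsPiecewiseLoop.intervalIntegrable_deriv_snd {c : ℝ → ℝ × ℝ} (hc : IsPiecewiseLoop c) :
    IntervalIntegrable (deriv fun t => (c t).2) volume 0 1 := by
  obtain ⟨C, -, hC⟩ := hc.exists_ae_bound
  refine intervalIntegrable_of_ae_bound (C := C) (measurable_deriv _).aestronglyMeasurable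
    (hC.mono fun t h ht => ?_)
  rw [deriv_snd_of_differentiableAt (h ht).2.1]
  exact (norm_snd_le _).trans (h ht).2.2

/-- The integral of an exact form along a loop vanishes. -/
theorem IsPiecewiseLoop.integral_fderiv_eq_zero {E : Type*} [NormedAddCommGroup E]
    [NormedSpace ℝ E] [CompleteSpace E] {c : ℝ → ℝ × ℝ} (hc : IsPiecewiseLoop c)
    {G : ℝ × ℝ → E} {G' : ℝ × ℝ → ℝ × ℝ →L[ℝ] E}
    (hG : ∀ s ∈ Icc (0 : ℝ) 1, HasFDerivAt G (G' (c s)) (c s))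
    (hG' : ContinuousOn G' (c '' Icc 0 1)) :
    ∫ s in (0 : ℝ)..1, G' (c s) (deriv c s) = 0 := by
  obtain ⟨S, hS, C, hC⟩ := hc.exists_bound
  obtain ⟨C', -, hC'⟩ := hc.exists_ae_bound
  have hcont : ContinuousOn (fun s => G' (c s)) (Icc 0 1) :=
    hG'.comp hc.continuousOn (mapsTo_image c _)
  obtain ⟨D, hD⟩ := isCompact_Icc.exists_bound_of_continuousOn hcont
  rw [integral_eq_of_hasDerivAt_off_countable_of_le (fun s => G (c s)) _
    zero_le_one hS ?_ ?_ ?_]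
  · simp [hc.closed]
  · exact fun s hs => (hG s hs).continuousAt.comp_continuousWithinAt (hc.continuousOn s hs)
  · exact fun s hs => (hG s (Ioo_subset_Icc_self hs.1)).comp_hasDerivAt s
      (hC s hs).1.hasDerivAt
  · refine intervalIntegrable_of_ae_bound (C := D * C') ?_ (hC'.mono fun t h ht => ?_)
    · have hm : AEStronglyMeasurable (fun s => G' (c s)) (volume.restrict (uIoc 0 1)) := by
        rw [uIoc_of_le zero_le_one]
        exact (hcont.aestronglyMeasurable measurableSet_Icc).mono_measure
          (Measure.restrict_mono Ioc_subset_Icc_self le_rfl)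
      exact (ContinuousLinearMap.apply ℝ E : (ℝ × ℝ) →L[ℝ] _).flip.aestronglyMeasurable_comp₂ hm
        (measurable_deriv c).aestronglyMeasurable
    · obtain ⟨h1, -, h2⟩ := h ht
      exact (ContinuousLinearMap.le_opNorm _ _).trans
        (mul_le_mul (hD t h1) h2 (norm_nonneg _) ((norm_nonneg _).trans (hD t h1)))

/-- Extend `c` to the plane by ignoring the second coordinate. The differentiable part of the curve
is then the image of a subset of a line, and differentiable maps between equal dimensions preserve
null sets. The remaining points are countable. -/
theorem IsPiecewiseLoop.volume_image {c : ℝ → ℝ × ℝ} (hc : IsPiecewiseLoop c) :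
    volume (c '' Icc 0 1) = 0 := by
  obtain ⟨S, hS, C, hC⟩ := hc.exists_bound
  have h1 : volume ((fun x : ℝ × ℝ => c x.1) '' ((Ioo 0 1 \ S) ×ˢ {0})) = 0 := by
    refine addHaar_image_eq_zero_of_differentiableOn_of_addHaar_eq_zero volume ?_ ?_
    · exact fun x hx => ((hC x.1 hx.1).1.comp x differentiableAt_fst).differentiableWithinAt
    · rw [Measure.volume_eq_prod, Measure.prod_prod]
      simp
  have h2 : (c '' (S ∪ {0, 1})).Countable :=
    (hS.union ((Set.finite_singleton (1 : ℝ)).insert 0).countable).image c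
  refine measure_mono_null ?_ (measure_union_null h1 (h2.measure_zero volume))
  rintro _ ⟨t, ht, rfl⟩
  by_cases hts : t ∈ S ∪ {0, 1}
  · exact Or.inr ⟨t, hts, rfl⟩
  · simp only [mem_union, mem_insert_iff, mem_singleton_iff, not_or] at hts
    exact Or.inl ⟨(t, 0), ⟨⟨⟨lt_of_le_of_ne ht.1 (Ne.symm hts.2.1),
      lt_of_le_of_ne ht.2 hts.2.2⟩, hts.1⟩, rfl⟩, rfl⟩

/-! ### The winding number vanishes outside the enclosed region -/

/-- The identification of the phase plane with `ℂ`. -/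
def planeToComplex : (ℝ × ℝ) ≃L[ℝ] ℂ := Complex.equivRealProdCLM.symm

@[simp] theorem planeToComplex_re (x : ℝ × ℝ) : (planeToComplex x).re = x.1 := rfl

@[simp] theorem planeToComplex_im (x : ℝ × ℝ) : (planeToComplex x).im = x.2 := rfl

/-- The Cauchy integral `∮ dζ / (ζ - z)` along `c`. -/
def cauchyIntegral (c : ℝ → ℝ × ℝ) (z : ℂ) : ℂ :=
  ∫ s in (0 : ℝ)..1, planeToComplex (deriv c s) / (planeToComplex (c s) - z)

/-- The plane carries the sup norm, so `planeToComplex` is not an isometry. This one-sided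
comparison is all that the distance estimates use. -/
theorem norm_le_norm_planeToComplex (x : ℝ × ℝ) : ‖x‖ ≤ ‖planeToComplex x‖ := by
  rw [Prod.norm_def]
  refine max_le ?_ ?_
  · simpa using Complex.abs_re_le_norm (planeToComplex x)
  · simpa using Complex.abs_im_le_norm (planeToComplex x)

theorem IsPiecewiseLoop.exists_ae_bound_complex {c : ℝ → ℝ × ℝ} (hc : IsPiecewiseLoop c) :
    ∃ C : ℝ, 0 ≤ C ∧ ∀ᵐ t, t ∈ uIoc (0 : ℝ) 1 → t ∈ Icc (0 : ℝ) 1 ∧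
      ‖planeToComplex (deriv c t)‖ ≤ C := by
  obtain ⟨C, hC0, hC⟩ := hc.exists_ae_bound
  refine ⟨‖(planeToComplex : (ℝ × ℝ) →L[ℝ] ℂ)‖ * C, by positivity, hC.mono fun t h ht => ?_⟩
  exact ⟨(h ht).1, ((planeToComplex : (ℝ × ℝ) →L[ℝ] ℂ).le_opNorm _).trans
    (mul_le_mul_of_nonneg_left (h ht).2.2 (norm_nonneg _))⟩

theorem IsPiecewiseLoop.aestronglyMeasurable_complex {c : ℝ → ℝ × ℝ} (hc : IsPiecewiseLoop c) :
    AEStronglyMeasurable (fun s => planeToComplex (c s)) (volume.restrict (uIoc 0 1)) := by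
  rw [uIoc_of_le zero_le_one]
  exact ((planeToComplex.continuous.comp_continuousOn hc.continuousOn).aestronglyMeasurable
    measurableSet_Icc).mono_measure (Measure.restrict_mono Ioc_subset_Icc_self le_rfl)

theorem aestronglyMeasurable_planeToComplex_deriv (c : ℝ → ℝ × ℝ) (μ : Measure ℝ) :
    AEStronglyMeasurable (fun s => planeToComplex (deriv c s)) μ :=
  (planeToComplex.continuous.measurable.comp (measurable_deriv c)).aestronglyMeasurable

theorem IsPiecewiseLoop.intervalIntegrable_cauchy {c : ℝ → ℝ × ℝ} (hc : IsPiecewiseLoop c)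
    {z : ℂ} {δ : ℝ} (hδ : 0 < δ) (hz : ∀ s ∈ Icc (0 : ℝ) 1, δ ≤ ‖planeToComplex (c s) - z‖) :
    IntervalIntegrable (fun s => planeToComplex (deriv c s) / (planeToComplex (c s) - z))
      volume 0 1 := by
  obtain ⟨C, hC0, hC⟩ := hc.exists_ae_bound_complex
  refine intervalIntegrable_of_ae_bound (C := C / δ)
    ((aestronglyMeasurable_planeToComplex_deriv c _).div₀
      (hc.aestronglyMeasurable_complex.sub aestronglyMeasurable_const)) (hC.mono fun t h ht => ?_)
  rw [norm_div]
  exact div_le_div₀ hC0 (h ht).2 hδ (hz t (h ht).1)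

theorem IsPiecewiseLoop.exists_dist_pos {c : ℝ → ℝ × ℝ} (hc : IsPiecewiseLoop c) {x : ℝ × ℝ}
    (hx : x ∈ (c '' Icc 0 1)ᶜ) :
    ∃ δ > 0, ∀ s ∈ Icc (0 : ℝ) 1, δ ≤ ‖planeToComplex (c s) - planeToComplex x‖ := by
  have hK : IsClosed (c '' Icc 0 1) :=
    (isCompact_Icc.image_of_continuousOn hc.continuousOn).isClosed
  obtain ⟨ε, hε, hb⟩ := Metric.isOpen_iff.1 hK.isOpen_compl x hx
  refine ⟨ε, hε, fun s hs => ?_⟩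
  rw [← map_sub]
  refine le_trans ?_ (norm_le_norm_planeToComplex _)
  by_contra h
  exact hb (by rwa [Metric.mem_ball, dist_eq_norm, ← not_le]) ⟨s, hs, rfl⟩

/-- The integrand of the winding number is the imaginary part of `dζ / (ζ - z)`. -/
theorem IsPiecewiseLoop.windingNumber_eq {c : ℝ → ℝ × ℝ} (hc : IsPiecewiseLoop c) {x : ℝ × ℝ}
    (hx : x ∈ (c '' Icc 0 1)ᶜ) :
    windingNumber c x = 1 / (2 * Real.pi) * (cauchyIntegral c (planeToComplex x)).im := by
  obtain ⟨δ, hδ, hz⟩ := hc.exists_dist_pos hx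
  have hi := hc.intervalIntegrable_cauchy hδ hz
  obtain ⟨C, -, hC⟩ := hc.exists_ae_bound
  rw [windingNumber, cauchyIntegral]
  have := Complex.imCLM.intervalIntegral_comp_comm hi
  simp only [Complex.imCLM_apply] at this
  rw [← this]
  congr 1
  refine intervalIntegral.integral_congr_ae (hC.mono fun t h ht => ?_)
  rw [deriv_fst_of_differentiableAt (h ht).2.1, deriv_snd_of_differentiableAt (h ht).2.1,
    Complex.div_im]
  simp only [Complex.sub_re, Complex.sub_im, planeToComplex_re, planeToComplex_im,
    Complex.normSq_apply]
  rw [← sub_div, ← sq, ← sq]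
  ring_nf

/-- The integrand has the single-valued primitive `-1 / (ζ - x)` along the curve. -/
theorem IsPiecewiseLoop.integral_div_sub_sq_eq_zero {c : ℝ → ℝ × ℝ} (hc : IsPiecewiseLoop c)
    {x : ℝ × ℝ} (hx : x ∈ (c '' Icc 0 1)ᶜ) :
    ∫ s in (0 : ℝ)..1,
      planeToComplex (deriv c s) / (planeToComplex (c s) - planeToComplex x) ^ 2 = 0 := by
  have hne : ∀ s ∈ Icc (0 : ℝ) 1, planeToComplex (c s) - planeToComplex x ≠ 0 :=
    fun s hs h => hx ⟨s, hs, planeToComplex.injective (sub_eq_zero.1 h)⟩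
  have key := hc.integral_fderiv_eq_zero
    (G := fun y => -(planeToComplex y - planeToComplex x)⁻¹)
    (G' := fun y => ((planeToComplex y - planeToComplex x) ^ 2)⁻¹ •
      (planeToComplex : (ℝ × ℝ) →L[ℝ] ℂ)) (fun s hs => ?_) ?_
  · rw [← key]
    refine intervalIntegral.integral_congr fun s _ => ?_
    exact div_eq_inv_mul _ _
  · have h1 : HasFDerivAt (fun y => planeToComplex y - planeToComplex x)
        (planeToComplex : (ℝ × ℝ) →L[ℝ] ℂ) (c s) := planeToComplex.hasFDerivAt.sub_const _
    have h3 := (hasDerivAt_inv (hne s hs)).neg.comp_hasFDerivAt (c s) h1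
    rw [neg_neg] at h3
    exact h3
  · have h1 : Continuous fun y : ℝ × ℝ => (planeToComplex y - planeToComplex x) ^ 2 :=
      (planeToComplex.continuous.sub continuous_const).pow 2
    refine ContinuousOn.smul (h1.continuousOn.inv₀ ?_) continuousOn_const
    · rintro _ ⟨s, hs, rfl⟩
      exact pow_ne_zero 2 (hne s hs)

/-- Differentiation under the integral sign gives `∮ dζ / (ζ - z)²`, which is zero. The integrand
stays dominated within half the distance to the curve. -/
theorem IsPiecewiseLoop.hasDerivAt_cauchyIntegral {c : ℝ → ℝ × ℝ} (hc : IsPiecewiseLoop c)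
    {x : ℝ × ℝ} (hx : x ∈ (c '' Icc 0 1)ᶜ) :
    HasDerivAt (cauchyIntegral c) 0 (planeToComplex x) := by
  obtain ⟨δ, hδ, hz⟩ := hc.exists_dist_pos hx
  obtain ⟨C, hC0, hC⟩ := hc.exists_ae_bound_complex
  have hnear : ∀ z ∈ Metric.ball (planeToComplex x) (δ / 2), ∀ s ∈ Icc (0 : ℝ) 1,
      δ / 2 ≤ ‖planeToComplex (c s) - z‖ := fun z hzb s hs => by
    rw [Metric.mem_ball, dist_eq_norm] at hzb
    have h1 := norm_sub_le_norm_sub_add_norm_sub (planeToComplex (c s)) z (planeToComplex x)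
    linarith [hz s hs]
  have hm := hc.aestronglyMeasurable_complex
  have h := (intervalIntegral.hasDerivAt_integral_of_dominated_loc_of_deriv_le
    (μ := volume) (a := 0) (b := 1)
    (F := fun z s => planeToComplex (deriv c s) / (planeToComplex (c s) - z))
    (F' := fun z s => planeToComplex (deriv c s) / (planeToComplex (c s) - z) ^ 2)
    (bound := fun _ => C / (δ / 2) ^ 2)
    (Metric.ball_mem_nhds (planeToComplex x) (half_pos hδ))
    (Filter.Eventually.of_forall fun z =>
      (aestronglyMeasurable_planeToComplex_deriv c _).div₀ (hm.sub aestronglyMeasurable_const))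
    (hc.intervalIntegrable_cauchy hδ hz)
    ((aestronglyMeasurable_planeToComplex_deriv c _).div₀
      ((hm.sub aestronglyMeasurable_const).pow 2))
    (hC.mono fun t h ht z hzb => ?_) intervalIntegrable_const
    (hC.mono fun t h ht z hzb => ?_)).2
  · rw [hc.integral_div_sub_sq_eq_zero hx] at h
    exact h
  · rw [norm_div, norm_pow]
    exact div_le_div₀ hC0 (h ht).2 (by positivity)
      (pow_le_pow_left₀ (by positivity) (hnear z hzb t (h ht).1) 2)
  · have hne' : planeToComplex (c t) - z ≠ 0 :=
      norm_pos_iff.1 ((half_pos hδ).trans_le (hnear z hzb t (h ht).1))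
    have h1 : HasDerivAt (fun z => planeToComplex (c t) - z) (-1) z :=
      (hasDerivAt_id z).const_sub _
    convert! (hasDerivAt_const z (planeToComplex (deriv c t))).fun_div h1 hne' using 1
    simp

/-- The Cauchy integral is constant on the component of `x`. This component is unbounded, and the
integral tends to zero at infinity. -/
theorem IsPiecewiseLoop.cauchyIntegral_eq_zero {c : ℝ → ℝ × ℝ} (hc : IsPiecewiseLoop c)
    {x : ℝ × ℝ} (hx : x ∈ (c '' Icc 0 1)ᶜ) (hx' : x ∉ enclosedRegion c) :
    cauchyIntegral c (planeToComplex x) = 0 := by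
  set U := connectedComponentIn (c '' Icc 0 1)ᶜ x with hU
  have hsub : U ⊆ (c '' Icc 0 1)ᶜ := connectedComponentIn_subset _ _
  have hopen : IsOpen U :=
    (isCompact_Icc.image_of_continuousOn hc.continuousOn).isClosed.isOpen_compl.connectedComponentIn
  have hd : ∀ y ∈ U, HasFDerivAt (fun y => cauchyIntegral c (planeToComplex y))
      (0 : (ℝ × ℝ) →L[ℝ] ℂ) y := fun y hy => by
    have := (hc.hasDerivAt_cauchyIntegral (hsub hy)).comp_hasFDerivAt y
      (planeToComplex : (ℝ × ℝ) →L[ℝ] ℂ).hasFDerivAt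
    exact this.congr_fderiv (ContinuousLinearMap.ext fun v => zero_mul (planeToComplex v))
  have hunb : ¬ Bornology.IsBounded U := fun h => hx' ⟨hx, h⟩
  obtain ⟨C, hC0, hC⟩ := hc.exists_ae_bound_complex
  obtain ⟨R, hR⟩ := hc.exists_norm_le
  rw [← norm_le_zero_iff]
  refine le_of_forall_pos_le_add fun ε hε => ?_
  -- At this distance `‖c t - y‖ ≥ C / ε + 1`, so the integrand is at most `ε`. The summand `1`
  -- keeps the denominator positive when `C = 0`.
  obtain ⟨y, hyU, hy⟩ : ∃ y ∈ U, R + (C / ε + 1) < ‖y‖ := by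
    by_contra! h
    exact hunb (isBounded_iff_forall_norm_le.2 ⟨_, h⟩)
  rw [hopen.is_const_of_fderiv_eq_zero (𝕜 := ℝ) isPreconnected_connectedComponentIn
    (fun y hy => (hd y hy).differentiableAt.differentiableWithinAt)
    (fun y hy => (hd y hy).fderiv) (mem_connectedComponentIn hx) hyU, zero_add]
  have hpos : 0 < C / ε + 1 := by positivity
  have hb : ∀ᵐ t, t ∈ uIoc (0 : ℝ) 1 →
      ‖planeToComplex (deriv c t) / (planeToComplex (c t) - planeToComplex y)‖ ≤ ε := by
    refine hC.mono fun t h ht => ?_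
    have h1 : C / ε + 1 ≤ ‖planeToComplex (c t) - planeToComplex y‖ := by
      rw [← map_sub]
      refine le_trans ?_ (norm_le_norm_planeToComplex _)
      have := norm_sub_norm_le y (c t)
      rw [norm_sub_rev] at this
      linarith [hR t (h ht).1]
    rw [norm_div, div_le_iff₀ (hpos.trans_le h1)]
    refine (h ht).2.trans (le_trans ?_ (mul_le_mul_of_nonneg_left h1 hε.le))
    rw [mul_add, mul_div_cancel₀ _ hε.ne']
    linarith
  have := intervalIntegral.norm_integral_le_of_norm_le_const_ae hb
  rwa [sub_zero, abs_one, mul_one] at this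

theorem IsPiecewiseLoop.windingNumber_eq_zero {c : ℝ → ℝ × ℝ} (hc : IsPiecewiseLoop c)
    {x : ℝ × ℝ} (hx : x ∈ (c '' Icc 0 1)ᶜ) (hx' : x ∉ enclosedRegion c) :
    windingNumber c x = 0 := by
  rw [hc.windingNumber_eq hx, hc.cauchyIntegral_eq_zero hx hx']
  simp

/-- Points of the enclosed region lie in every centered ball that contains the curve. -/
theorem norm_le_of_mem_enclosedRegion {c : ℝ → ℝ × ℝ} {R : ℝ}
    (hR : ∀ s ∈ Icc (0 : ℝ) 1, ‖c s‖ ≤ R) {x : ℝ × ℝ} (hx : x ∈ enclosedRegion c) : ‖x‖ ≤ R := by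
  by_contra! h
  have hR0 : 0 ≤ R := (norm_nonneg _).trans (hR 0 (by simp))
  have hx0 : 0 < ‖x‖ := hR0.trans_lt h
  -- The outward ray from `x` never meets the curve, so it lies in the component of `x` and makes it
  -- unbounded.
  have hray : (fun t : ℝ => t • x) '' Ici 1 ⊆ connectedComponentIn (c '' Icc 0 1)ᶜ x := by
    refine IsPreconnected.subset_connectedComponentIn
      (isPreconnected_Ici.image _ (by fun_prop)) ⟨1, by simp, by simp⟩ ?_
    rintro _ ⟨t, ht, rfl⟩ ⟨s, hs, hst⟩
    have h1 := hR s hs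
    have ht : 1 ≤ t := ht
    simp only at hst
    rw [hst, norm_smul, Real.norm_of_nonneg (by linarith)] at h1
    nlinarith
  obtain ⟨M, hM⟩ := isBounded_iff_forall_norm_le.1 (hx.2.subset hray)
  have h1 : 1 ≤ (|M| + 1) / ‖x‖ + 1 := by
    have : 0 ≤ (|M| + 1) / ‖x‖ := by positivity
    linarith
  have h2 := hM _ ⟨(|M| + 1) / ‖x‖ + 1, h1, rfl⟩
  simp only at h2
  rw [norm_smul, Real.norm_of_nonneg (by linarith), add_mul, div_mul_cancel₀ _ hx0.ne'] at h2
  linarith [le_abs_self M]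

/-! ### Green's theorem for loops -/

theorem continuous_integral_smul_comp_sub {E : Type*} [NormedAddCommGroup E] [NormedSpace ℝ E]
    {K : ℝ × ℝ → ℝ} (hK : LocallyIntegrable K)
    {G : ℝ × ℝ → E} (hG : Continuous G) (hGc : HasCompactSupport G) :
    Continuous fun y => ∫ t, K t • G (y - t) :=
  hGc.continuous_convolution_right (ContinuousLinearMap.lsmul ℝ ℝ) hK hG

theorem integral_comp_sub_mul (K G : ℝ × ℝ → ℝ) (y : ℝ × ℝ) :
    ∫ z, K (y - z) * G z = ∫ t, K t * G (y - t) := by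
  rw [← integral_sub_left_eq_self (fun t => K t * G (y - t)) volume y]
  simp

theorem IsPiecewiseLoop.aemeasurable {c : ℝ → ℝ × ℝ} (hc : IsPiecewiseLoop c) :
    AEMeasurable c (volume.restrict (uIoc 0 1)) := by
  rw [uIoc_of_le zero_le_one]
  exact (hc.continuousOn.aemeasurable measurableSet_Icc).mono_measure
    (Measure.restrict_mono Ioc_subset_Icc_self le_rfl)

/-- The Fubini hypothesis, despite the singularity at `z = c s`: integrating in `z` first leaves the
convolution `|K| * |G|`, which is continuous along the curve, times the integrable `|w|`. -/
theorem IsPiecewiseLoop.integrable_kernel_prod {c : ℝ → ℝ × ℝ} (hc : IsPiecewiseLoop c)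
    {K : ℝ × ℝ → ℝ} (hKm : Measurable K) (hK : LocallyIntegrable K) {G : ℝ × ℝ → ℝ}
    (hG : Continuous G) (hGc : HasCompactSupport G) {w : ℝ → ℝ} (hwm : Measurable w)
    (hw : IntervalIntegrable w volume 0 1) :
    Integrable (Function.uncurry fun s z => K (c s - z) * G z * w s)
      ((volume.restrict (uIoc 0 1)).prod volume) := by
  have hm : AEStronglyMeasurable (Function.uncurry fun s z => K (c s - z) * G z * w s)
      ((volume.restrict (uIoc 0 1)).prod (volume : Measure (ℝ × ℝ))) := by
    have h1 : AEMeasurable (fun p : ℝ × (ℝ × ℝ) => c p.1 - p.2)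
        ((volume.restrict (uIoc 0 1)).prod volume) :=
      (hc.aemeasurable.comp_quasiMeasurePreserving
        Measure.quasiMeasurePreserving_fst).sub measurable_snd.aemeasurable
    exact (((hKm.comp_aemeasurable h1).mul
      (hG.measurable.comp measurable_snd).aemeasurable).mul
      (hwm.comp measurable_fst).aemeasurable).aestronglyMeasurable
  rw [integrable_prod_iff hm]
  constructor
  · filter_upwards with s
    have := (integrable_smul_comp_sub hK hG hGc (c s)).comp_sub_left (c s)
    simp only [sub_sub_cancel, smul_eq_mul] at this
    exact this.mul_const (w s)
  · have h1 : ∀ s, ∫ z, ‖Function.uncurry (fun s z => K (c s - z) * G z * w s) (s, z)‖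
        = (∫ t, |K t| * |G (c s - t)|) * |w s| := fun s => by
      rw [← integral_comp_sub_mul (fun t => |K t|) (fun z => |G z|), ← integral_mul_const]
      simp [Function.uncurry]
    simp only [h1]
    have h2 := continuous_integral_smul_comp_sub (K := fun t => |K t|) (G := fun t => |G t|)
      (fun x => (hK x).norm) hG.abs hGc.norm
    have h3 : ContinuousOn (fun s => ∫ t, |K t| * |G (c s - t)|) (uIcc 0 1) := by
      rw [uIcc_of_le zero_le_one]; exact h2.comp_continuousOn hc.continuousOn
    exact intervalIntegrable_iff.1 (hw.norm.continuousOn_mul h3)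

theorem IsPiecewiseLoop.integrable_integral_kernel {c : ℝ → ℝ × ℝ} (hc : IsPiecewiseLoop c)
    {K : ℝ × ℝ → ℝ} (hKm : Measurable K) (hK : LocallyIntegrable K) {G : ℝ × ℝ → ℝ}
    (hG : Continuous G) (hGc : HasCompactSupport G) {w : ℝ → ℝ} (hwm : Measurable w)
    (hw : IntervalIntegrable w volume 0 1) :
    Integrable fun z => ∫ s in (0 : ℝ)..1, K (c s - z) * G z * w s := by
  simp only [intervalIntegral.intervalIntegral_eq_integral_uIoc, zero_le_one, if_true, one_smul]
  exact (hc.integrable_kernel_prod hKm hK hG hGc hwm hw).integral_prod_right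

theorem IsPiecewiseLoop.integral_integral_kernel {c : ℝ → ℝ × ℝ} (hc : IsPiecewiseLoop c)
    {K : ℝ × ℝ → ℝ} (hKm : Measurable K) (hK : LocallyIntegrable K) {G : ℝ × ℝ → ℝ}
    (hG : Continuous G) (hGc : HasCompactSupport G) {w : ℝ → ℝ} (hwm : Measurable w)
    (hw : IntervalIntegrable w volume 0 1) :
    ∫ z, ∫ s in (0 : ℝ)..1, K (c s - z) * G z * w s
      = ∫ s in (0 : ℝ)..1, (∫ t, K t * G (c s - t)) * w s := by
  simp only [intervalIntegral.intervalIntegral_eq_integral_uIoc, zero_le_one, if_true, one_smul]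
  rw [← integral_integral_swap (hc.integrable_kernel_prod hKm hK hG hGc hwm hw)]
  simp only [integral_mul_const, integral_comp_sub_mul]

theorem IsPiecewiseLoop.windingNumber_eq_sub {c : ℝ → ℝ × ℝ} (hc : IsPiecewiseLoop c)
    {z : ℝ × ℝ} (hz : z ∈ (c '' Icc 0 1)ᶜ) :
    windingNumber c z = 1 / (2 * Real.pi) *
      ((∫ s in (0 : ℝ)..1, kernelFst (c s - z) * deriv (fun t => (c t).2) s)
        - ∫ s in (0 : ℝ)..1, kernelSnd (c s - z) * deriv (fun t => (c t).1) s) := by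
  have hne : ∀ s ∈ Icc (0 : ℝ) 1, (c s - z).1 ^ 2 + (c s - z).2 ^ 2 ≠ 0 := fun s hs h => by
    have h1 : c s - z ≠ 0 := fun h => hz ⟨s, hs, sub_eq_zero.1 h⟩
    have h2 := norm_sq_le_sq_add_sq (c s - z)
    have h3 : 0 < ‖c s - z‖ ^ 2 := pow_pos (norm_pos_iff.2 h1) 2
    linarith
  have hcs : ContinuousOn (fun s => c s - z) (uIcc 0 1) := by
    rw [uIcc_of_le zero_le_one]; exact hc.continuousOn.sub continuousOn_const
  have hd : ContinuousOn (fun s => (c s - z).1 ^ 2 + (c s - z).2 ^ 2) (uIcc 0 1) :=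
    (hcs.fst.pow 2).add (hcs.snd.pow 2)
  rw [uIcc_of_le zero_le_one] at hcs hd
  have h1 : ContinuousOn (fun s => kernelFst (c s - z)) (Icc 0 1) := hcs.fst.div hd hne
  have h2 : ContinuousOn (fun s => kernelSnd (c s - z)) (Icc 0 1) := hcs.snd.div hd hne
  rw [← uIcc_of_le zero_le_one] at h1 h2
  rw [windingNumber, ← intervalIntegral.integral_sub
    (hc.intervalIntegrable_deriv_snd.continuousOn_mul h1)
    (hc.intervalIntegrable_deriv_fst.continuousOn_mul h2)]
  congr 1
  refine intervalIntegral.integral_congr fun s _ => ?_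
  simp only [kernelFst, kernelSnd, Prod.fst_sub, Prod.snd_sub]
  ring

/-- Green's theorem, with the winding number as weight, for compactly supported functions. -/
theorem IsPiecewiseLoop.integral_windingNumber_mul {c : ℝ → ℝ × ℝ} (hc : IsPiecewiseLoop c)
    {F : ℝ × ℝ → ℝ} (hF : ContDiff ℝ 1 F) (hFc : HasCompactSupport F) :
    ∫ z, windingNumber c z * fderiv ℝ F z (0, 1)
      = -∫ s in (0 : ℝ)..1, F (c s) * deriv (fun t => (c t).1) s := by
  set G : ℝ × ℝ → ℝ := fun z => fderiv ℝ F z (0, 1) with hGdef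
  have hG : Continuous G := (hF.continuous_fderiv one_ne_zero).clm_apply continuous_const
  have hGc : HasCompactSupport G := hFc.fderiv_apply ℝ _
  have m1 := measurable_deriv fun t => (c t).1
  have m2 := measurable_deriv fun t => (c t).2
  have i1 := hc.intervalIntegrable_deriv_fst
  have i2 := hc.intervalIntegrable_deriv_snd
  have k1 := locallyIntegrable_kernelFst
  have k2 := locallyIntegrable_kernelSnd
  have hae : ∀ᵐ z, z ∈ (c '' Icc 0 1)ᶜ := compl_mem_ae_iff.2 hc.volume_image
  have step : ∀ᵐ z, windingNumber c z * G z = 1 / (2 * Real.pi) *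
      ((∫ s in (0 : ℝ)..1, kernelFst (c s - z) * G z * deriv (fun t => (c t).2) s)
        - ∫ s in (0 : ℝ)..1, kernelSnd (c s - z) * G z * deriv (fun t => (c t).1) s) := by
    filter_upwards [hae] with z hz
    rw [hc.windingNumber_eq_sub hz, mul_assoc, sub_mul, ← intervalIntegral.integral_mul_const,
      ← intervalIntegral.integral_mul_const]
    simp only [mul_right_comm]
  rw [integral_congr_ae step, integral_const_mul, integral_sub
    (hc.integrable_integral_kernel measurable_kernelFst k1 hG hGc m2 i2)
    (hc.integrable_integral_kernel measurable_kernelSnd k2 hG hGc m1 i1),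
    hc.integral_integral_kernel measurable_kernelFst k1 hG hGc m2 i2,
    hc.integral_integral_kernel measurable_kernelSnd k2 hG hGc m1 i1]
  -- `K₁ * F` is the primitive that makes the combined one-form in `hsum` exact.
  have hV := fun y => hasFDerivAt_integral_mul_comp_sub k1 hF hFc y
  have hex := hc.integral_fderiv_eq_zero (E := ℝ) (fun s _ => hV (c s))
    (continuous_integral_smul_comp_sub k1 (hF.continuous_fderiv one_ne_zero)
      (hFc.fderiv ℝ)).continuousOn
  have hcc : ∀ {φ : ℝ × ℝ → ℝ}, Continuous φ → ContinuousOn (fun s => φ (c s)) (uIcc 0 1) :=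
    fun hφ => by rw [uIcc_of_le zero_le_one]; exact hφ.comp_continuousOn hc.continuousOn
  have j1 := i2.continuousOn_mul (hcc (continuous_integral_smul_comp_sub k1 hG hGc))
  have j2 := i1.continuousOn_mul (hcc (continuous_integral_smul_comp_sub k2 hG hGc))
  have j3 := (i1.continuousOn_mul (hcc hF.continuous)).const_mul (2 * Real.pi)
  simp only [smul_eq_mul] at j1 j2
  have hsum : (∫ s in (0 : ℝ)..1, (((∫ t, kernelFst t * G (c s - t)) * deriv (fun t => (c t).2) s
      - (∫ t, kernelSnd t * G (c s - t)) * deriv (fun t => (c t).1) s)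
      + 2 * Real.pi * (F (c s) * deriv (fun t => (c t).1) s))) = 0 := by
    refine Eq.trans ?_ hex
    obtain ⟨C, -, hC⟩ := hc.exists_ae_bound
    refine intervalIntegral.integral_congr_ae ?_
    filter_upwards [hC] with s h hs
    rw [deriv_fst_of_differentiableAt (h hs).2.1, deriv_snd_of_differentiableAt (h hs).2.1]
    have hv : deriv c s = (deriv c s).1 • ((1 : ℝ), (0 : ℝ))
        + (deriv c s).2 • ((0 : ℝ), (1 : ℝ)) := by simp
    have happly : (∫ t, kernelFst t • fderiv ℝ F (c s - t)) (deriv c s)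
        = (deriv c s).1 * (∫ t, kernelFst t * fderiv ℝ F (c s - t) (1, 0))
          + (deriv c s).2 * ∫ t, kernelFst t * fderiv ℝ F (c s - t) (0, 1) := by
      rw [← integral_smul_fderiv_apply k1 hF hFc, ← integral_smul_fderiv_apply k1 hF hFc,
        ← smul_eq_mul, ← smul_eq_mul, ← map_smul, ← map_smul, ← map_add, ← hv]
    rw [happly]
    have := integral_kernel_fderiv_sub hF hFc (c s)
    simp only [hGdef]
    -- The `dp` terms agree. The `dq` terms agree by `K₁ * ∂₁F + K₂ * ∂₂F = 2πF`.
    linear_combination (-(deriv c s).1) * this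
  rw [intervalIntegral.integral_add (j1.sub j2) j3, intervalIntegral.integral_sub j1 j2,
    intervalIntegral.integral_const_mul] at hsum
  have hpi := Real.pi_ne_zero
  field_simp
  linarith

/-- Green's theorem for a loop and a continuously differentiable function: each enclosed point is
weighted by the winding number. -/
theorem IsPiecewiseLoop.signedIntegral_fderiv {c : ℝ → ℝ × ℝ} (hc : IsPiecewiseLoop c)
    {F : ℝ × ℝ → ℝ} (hF : ContDiff ℝ 1 F) :
    signedIntegral c (fun z => fderiv ℝ F z (0, 1))
      = -∫ s in (0 : ℝ)..1, F (c s) * deriv (fun t => (c t).1) s := by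
  obtain ⟨R, hR⟩ := hc.exists_norm_le
  have hR0 : 0 ≤ R := (norm_nonneg _).trans (hR 0 (by simp))
  -- The plateau has radius `R + 1` rather than `R`, so that `χ F` and `F` agree near each point of
  -- norm at most `R` and so have equal derivatives there.
  let χ : ContDiffBump (0 : ℝ × ℝ) := ⟨R + 1, R + 2, by linarith, by linarith⟩
  have hχ : ∀ z : ℝ × ℝ, ‖z‖ < R + 1 → χ z = 1 := fun z hz =>
    χ.one_of_mem_closedBall (by simpa using! hz.le)
  have hFχ : ContDiff ℝ 1 (fun z => χ z * F z) := χ.contDiff.mul hF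
  have hloc : ∀ z : ℝ × ℝ, ‖z‖ ≤ R → (fun z => χ z * F z) =ᶠ[nhds z] F := fun z hz => by
    filter_upwards [Metric.isOpen_ball.mem_nhds
      (show z ∈ Metric.ball 0 (R + 1) by simpa using by linarith)] with y hy
    rw [hχ y (by simpa using hy), one_mul]
  have key := hc.integral_windingNumber_mul hFχ χ.hasCompactSupport.mul_right
  have hbdry : ∫ s in (0 : ℝ)..1, χ (c s) * F (c s) * deriv (fun t => (c t).1) s
      = ∫ s in (0 : ℝ)..1, F (c s) * deriv (fun t => (c t).1) s := by
    refine intervalIntegral.integral_congr fun s hs => ?_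
    rw [uIcc_of_le zero_le_one] at hs
    simp only [(hloc (c s) (hR s hs)).eq_of_nhds]
  rw [← hbdry, ← key, signedIntegral, ← integral_indicator
    (isOpen_enclosedRegion hc.continuousOn).measurableSet]
  have hae : ∀ᵐ z, z ∈ (c '' Icc 0 1)ᶜ := compl_mem_ae_iff.2 hc.volume_image
  refine integral_congr_ae (hae.mono fun z hz => ?_)
  by_cases hz' : z ∈ enclosedRegion c
  · simp only [indicator_of_mem hz', (hloc z (norm_le_of_mem_enclosedRegion hR hz')).fderiv_eq]
  · simp only [indicator_of_notMem hz', hc.windingNumber_eq_zero hz hz', zero_mul]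

/-! ### Gradients and Hessians -/

section Gradient

variable {V : Type*} [NormedAddCommGroup V] [InnerProductSpace ℝ V] [CompleteSpace V]

/-- The Riesz representation of continuous linear forms, as a real-linear map. -/
def rieszCLM (V : Type*) [NormedAddCommGroup V] [InnerProductSpace ℝ V] [CompleteSpace V] :
    (V →L[ℝ] ℝ) →L[ℝ] V where
  toFun l := (InnerProductSpace.toDual ℝ V).symm l
  map_add' := map_add _
  map_smul' r l := by simp
  cont := (InnerProductSpace.toDual ℝ V).symm.continuous

theorem gradient_eq_rieszCLM (f : V → ℝ) : gradient f = fun x => rieszCLM V (fderiv ℝ f x) := rfl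

theorem contDiff_gradient {f : V → ℝ} (hf : ContDiff ℝ 2 f) : ContDiff ℝ 1 (gradient f) := by
  rw [gradient_eq_rieszCLM]
  exact (rieszCLM V).contDiff.comp (hf.fderiv_right (by norm_num))

theorem hasFDerivAt_gradient {f : V → ℝ} (hf : ContDiff ℝ 2 f) (x : V) :
    HasFDerivAt (gradient f) (hessianMap f x) x :=
  ((contDiff_gradient hf).differentiable one_ne_zero x).hasFDerivAt

theorem inner_hessianMap {f : V → ℝ} (hf : ContDiff ℝ 2 f) (x u v : V) :
    inner ℝ (hessianMap f x u) v = fderiv ℝ (fderiv ℝ f) x u v := by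
  have hd : DifferentiableAt ℝ (fderiv ℝ f) x :=
    (hf.fderiv_right (m := 1) (by norm_num)).differentiable one_ne_zero x
  have h : hessianMap f x = (rieszCLM V).comp (fderiv ℝ (fderiv ℝ f) x) :=
    ((rieszCLM V).hasFDerivAt.comp x hd.hasFDerivAt).fderiv
  rw [h]
  exact InnerProductSpace.toDual_symm_apply

/-- Symmetry of the second derivative. It removes the `dq ∧ dq` terms from the two-form identities.
-/
theorem inner_hessianMap_comm {f : V → ℝ} (hf : ContDiff ℝ 2 f) (x u v : V) :
    inner ℝ (hessianMap f x u) v = inner ℝ u (hessianMap f x v) := by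
  rw [real_inner_comm (hessianMap f x v) u, inner_hessianMap hf, inner_hessianMap hf]
  exact hf.contDiffAt.isSymmSndFDerivAt (by simp) u v

theorem gradient_kineticEnergy (p : V) : gradient (kineticEnergy (V := V)) p = p := by
  refine HasGradientAt.gradient ?_
  rw [hasGradientAt_iff_hasFDerivAt]
  have h := (hasStrictFDerivAt_norm_sq p).hasFDerivAt.const_mul (1 / 2 : ℝ)
  refine h.congr_fderiv ?_
  ext v
  simp

/-! ### The derivative of one step -/

theorem contDiff_forceNP {f : V → ℝ} (hf : ContDiff ℝ 2 f) (L κ : ℝ) :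
    ContDiff ℝ 1 (forceNP f L κ) := by
  have hg := contDiff_gradient hf
  unfold forceNP
  exact ((contDiff_snd.const_smul _).neg).sub (((hg.comp (contDiff_fst.add
    (contDiff_snd.const_smul _))).sub (hg.comp contDiff_fst)).const_smul _)

theorem contDiff_nextMomentum {f : V → ℝ} (hf : ContDiff ℝ 2 f) (L κ Ts : ℝ) :
    ContDiff ℝ 1 (nextMomentum f L κ Ts) := by
  have hg := contDiff_gradient hf
  unfold nextMomentum
  exact contDiff_snd.add ((((hg.comp contDiff_fst).const_smul _).neg.add
    (contDiff_forceNP hf L κ)).const_smul _)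

theorem eulerStep_eq (f : V → ℝ) (L κ Ts : ℝ) (x : V × V) :
    eulerStep f L κ Ts x = (x.1 + Ts • nextMomentum f L κ Ts x, nextMomentum f L κ Ts x) := by
  rw [eulerStep, gradient_kineticEnergy]

theorem contDiff_eulerStep {f : V → ℝ} (hf : ContDiff ℝ 2 f) (L κ Ts : ℝ) :
    ContDiff ℝ 1 (eulerStep f L κ Ts) := by
  have hp := contDiff_nextMomentum hf L κ Ts
  have : eulerStep f L κ Ts
      = fun x => (x.1 + Ts • nextMomentum f L κ Ts x, nextMomentum f L κ Ts x) :=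
    funext (eulerStep_eq f L κ Ts)
  rw [this]
  exact (contDiff_fst.add (hp.const_smul _)).prodMk hp

theorem fderiv_forceNP_apply {f : V → ℝ} (hf : ContDiff ℝ 2 f) (L κ : ℝ) (x u : V × V) :
    fderiv ℝ (forceNP f L κ) x u = -((2 * dampingD κ) • u.2)
      - (1 / L) • (hessianMap f (x.1 + dampingBeta κ • x.2) (u.1 + dampingBeta κ • u.2)
        - hessianMap f x.1 u.1) := by
  have h1 : HasFDerivAt (fun x : V × V => x.1 + dampingBeta κ • x.2)
      (ContinuousLinearMap.fst ℝ V V + dampingBeta κ • ContinuousLinearMap.snd ℝ V V) x :=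
    hasFDerivAt_fst.add (hasFDerivAt_snd.const_smul _)
  have h2 := (hasFDerivAt_gradient hf (x.1 + dampingBeta κ • x.2)).comp x h1
  have h3 := (hasFDerivAt_gradient hf x.1).comp x (hasFDerivAt_fst (𝕜 := ℝ) (F := V))
  have h4 : HasFDerivAt (forceNP f L κ) _ x :=
    (hasFDerivAt_snd.const_smul (2 * dampingD κ)).neg.sub ((h2.sub h3).const_smul (1 / L))
  rw [h4.fderiv]
  rfl

theorem fderiv_nextMomentum_apply {f : V → ℝ} (hf : ContDiff ℝ 2 f) (L κ Ts : ℝ) (x u : V × V) :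
    fderiv ℝ (nextMomentum f L κ Ts) x u
      = u.2 + Ts • (-((1 / L) • hessianMap f x.1 u.1) + fderiv ℝ (forceNP f L κ) x u) := by
  have h3 := (hasFDerivAt_gradient hf x.1).comp x (hasFDerivAt_fst (𝕜 := ℝ) (F := V))
  have h5 := ((contDiff_forceNP hf L κ).differentiable one_ne_zero x).hasFDerivAt
  have h4 : HasFDerivAt (nextMomentum f L κ Ts) _ x :=
    hasFDerivAt_snd.add (((h3.const_smul (1 / L)).neg.add h5).const_smul Ts)
  rw [h4.fderiv]
  rfl

theorem fderiv_eulerStep_apply {f : V → ℝ} (hf : ContDiff ℝ 2 f) (L κ Ts : ℝ) (x u : V × V) :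
    fderiv ℝ (eulerStep f L κ Ts) x u = (u.1 + Ts • fderiv ℝ (nextMomentum f L κ Ts) x u,
      fderiv ℝ (nextMomentum f L κ Ts) x u) := by
  have hp := ((contDiff_nextMomentum hf L κ Ts).differentiable one_ne_zero x).hasFDerivAt
  have : eulerStep f L κ Ts
      = fun x => (x.1 + Ts • nextMomentum f L κ Ts x, nextMomentum f L κ Ts x) :=
    funext (eulerStep_eq f L κ Ts)
  have h : HasFDerivAt (eulerStep f L κ Ts) _ x :=
    this ▸ (hasFDerivAt_fst.add (hp.const_smul Ts)).prodMk hp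
  rw [h.fderiv]
  rfl

/-- The exterior derivative of `f_NP · dq` is the damping two-form. -/
theorem inner_fderiv_forceNP_sub {f : V → ℝ} (hf : ContDiff ℝ 2 f) (L κ : ℝ) (x u v : V × V) :
    inner ℝ (fderiv ℝ (forceNP f L κ) x u) v.1 - inner ℝ (fderiv ℝ (forceNP f L κ) x v) u.1
      = wedgeForm (dampingMap f L κ x) u v := by
  have e1 := inner_hessianMap_comm hf (x.1 + dampingBeta κ • x.2) u.1 v.1
  have e2 := inner_hessianMap_comm hf x.1 u.1 v.1
  rw [fderiv_forceNP_apply hf, fderiv_forceNP_apply hf]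
  simp only [wedgeForm, dampingMap, add_apply, smul_apply,
    ContinuousLinearMap.id_apply, map_add, map_smul, inner_sub_left, inner_neg_left,
    inner_add_left, inner_add_right, real_inner_smul_left, real_inner_smul_right]
  rw [real_inner_comm u.1 (hessianMap f (x.1 + dampingBeta κ • x.2) v.1), ← e1,
    real_inner_comm u.1 (hessianMap f x.1 v.1), ← e2, real_inner_comm v.1 u.2,
    real_inner_comm u.1 v.2,
    real_inner_comm v.1 (hessianMap f (x.1 + dampingBeta κ • x.2) u.2),
    real_inner_comm u.1 (hessianMap f (x.1 + dampingBeta κ • x.2) v.2)]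
  ring

/-- `dq⁺ ∧ dp⁺ = dq ∧ dp⁺`, because `q⁺ - q = Ts p⁺`. In `dp⁺` the potential force contributes a
symmetric form in `dq`, leaving `dq ∧ dp + Ts dq ∧ df_NP`, and `dq ∧ df_NP = -d(f_NP · dq)`. -/
theorem wedgeForm_fderiv_eulerStep {f : V → ℝ} (hf : ContDiff ℝ 2 f) (L κ Ts : ℝ)
    (x u v : V × V) :
    wedgeForm (ContinuousLinearMap.id ℝ V) (fderiv ℝ (eulerStep f L κ Ts) x u)
        (fderiv ℝ (eulerStep f L κ Ts) x v)
      = wedgeForm (ContinuousLinearMap.id ℝ V) u v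
        - Ts * wedgeForm (dampingMap f L κ x) u v := by
  have e2 := inner_hessianMap_comm hf x.1 u.1 v.1
  rw [← inner_fderiv_forceNP_sub hf, fderiv_eulerStep_apply hf, fderiv_eulerStep_apply hf]
  have hsymm := real_inner_comm (fderiv ℝ (nextMomentum f L κ Ts) x u)
    (fderiv ℝ (nextMomentum f L κ Ts) x v)
  simp only [wedgeForm, ContinuousLinearMap.id_apply, inner_add_left, real_inner_smul_left, hsymm]
  rw [fderiv_nextMomentum_apply hf, fderiv_nextMomentum_apply hf]
  simp only [inner_add_right, real_inner_smul_right, inner_neg_right, ← e2]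
  rw [real_inner_comm v.1 (hessianMap f x.1 u.1),
    real_inner_comm u.1 (fderiv ℝ (forceNP f L κ) x v),
    real_inner_comm v.1 (fderiv ℝ (forceNP f L κ) x u)]
  ring

end Gradient

/-! ### Contours in the plane -/

theorem lineIntegralDq_real (F : ℝ × ℝ → ℝ) (c : ℝ → ℝ × ℝ) :
    lineIntegralDq F c = ∫ s in (0 : ℝ)..1, F (c s) * deriv (fun t => (c t).1) s := by
  simp [lineIntegralDq, mul_comm]

theorem IsPiecewiseLoop.signedArea_eq {c : ℝ → ℝ × ℝ} (hc : IsPiecewiseLoop c) :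
    signedArea c = -∫ s in (0 : ℝ)..1, (c s).2 * deriv (fun t => (c t).1) s := by
  have h := hc.signedIntegral_fderiv (F := fun z => z.2) contDiff_snd
  rw [← h, signedArea]
  congr 1
  funext z
  simp [show fderiv ℝ (fun z : ℝ × ℝ => z.2) z = ContinuousLinearMap.snd ℝ ℝ ℝ from
    hasFDerivAt_snd.fderiv]

theorem hessianMap_real (f : ℝ → ℝ) (x h : ℝ) : hessianMap f x h = deriv (deriv f) x * h := by
  have : gradient f = deriv f := funext fun x => gradient_eq_deriv'
  rw [hessianMap, this, ← fderiv_apply_one_eq_deriv, mul_comm, ← smul_eq_mul, ← map_smul,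
    smul_eq_mul, mul_one]

/-- Green's formula only sees the `p`-derivative of `f_NP`, so the term in `∇f(q)` drops out. The
minus sign of that derivative cancels the one in the formula. -/
theorem IsPiecewiseLoop.lineIntegralDq_forceNP {c : ℝ → ℝ × ℝ} (hc : IsPiecewiseLoop c)
    {f : ℝ → ℝ} (hf : ContDiff ℝ 2 f) (L κ : ℝ) :
    lineIntegralDq (forceNP f L κ) c = signedIntegral c (fun z => 2 * dampingD κ
      + dampingBeta κ / L * deriv (deriv f) (z.1 + dampingBeta κ * z.2)) := by
  have h := hc.signedIntegral_fderiv (contDiff_forceNP hf L κ)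
  rw [lineIntegralDq_real, ← neg_neg (∫ s in (0 : ℝ)..1, _), ← h, signedIntegral, signedIntegral,
    ← integral_neg]
  congr 1
  funext z
  rw [fderiv_forceNP_apply hf]
  simp only [hessianMap_real, smul_eq_mul]
  ring

theorem IsPiecewiseLoop.signedArea_eulerStep_comp {c : ℝ → ℝ × ℝ} (hc : IsPiecewiseLoop c)
    {f : ℝ → ℝ} (hf : ContDiff ℝ 2 f) (L κ Ts : ℝ) :
    signedArea (eulerStep f L κ Ts ∘ c) - signedArea c
      = -Ts * lineIntegralDq (forceNP f L κ) c := by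
  have hψ := hc.comp (contDiff_eulerStep hf L κ Ts)
  set P := nextMomentum f L κ Ts with hP
  have hPd := contDiff_nextMomentum hf L κ Ts
  have hcc : ∀ {φ : ℝ × ℝ → ℝ}, Continuous φ → ContinuousOn (fun s => φ (c s)) (uIcc 0 1) :=
    fun hφ => by rw [uIcc_of_le zero_le_one]; exact hφ.comp_continuousOn hc.continuousOn
  have j1 := hc.intervalIntegrable_deriv_fst.continuousOn_mul (hcc continuous_snd)
  have j2 := hc.intervalIntegrable_deriv_fst.continuousOn_mul
    (hcc (contDiff_forceNP hf L κ).continuous)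
  have j3 := hψ.intervalIntegrable_deriv_fst.continuousOn_mul (hcc hPd.continuous)
  have hgrad : ∀ x, HasFDerivAt f ((ContinuousLinearMap.mul ℝ ℝ) (gradient f x)) x := fun x => by
    have := (hf.differentiable two_ne_zero x).hasDerivAt.hasFDerivAt
    rw [gradient_eq_deriv']
    refine this.congr_fderiv ?_
    ext
    simp
  have hex := hc.integral_fderiv_eq_zero (E := ℝ)
    -- `P dq⁺ = P dq + Ts P dP`. The second term and the potential force in `P dq` have this
    -- primitive.
    (G := fun z => Ts / 2 * P z ^ 2 - Ts / L * f z.1)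
    (G' := fun z => (Ts * P z) • fderiv ℝ P z
      - (Ts / L * gradient f z.1) • ContinuousLinearMap.fst ℝ ℝ ℝ) (fun s _ => ?_) ?_
  · have hsum : (∫ s in (0 : ℝ)..1,
        (P (c s) * deriv (fun t => ((eulerStep f L κ Ts ∘ c) t).1) s
          - (c s).2 * deriv (fun t => (c t).1) s
          - Ts * (forceNP f L κ (c s) * deriv (fun t => (c t).1) s))) = 0 := by
      refine Eq.trans ?_ hex
      obtain ⟨C, -, hC⟩ := hc.exists_ae_bound
      refine intervalIntegral.integral_congr_ae ?_
      filter_upwards [hC] with s h hs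
      have hds := (h hs).2.1
      have hcomp := ((contDiff_eulerStep hf L κ Ts).differentiable one_ne_zero
        (c s)).hasFDerivAt.comp_hasDerivAt s hds.hasDerivAt
      rw [deriv_fst_of_differentiableAt hds,
        deriv_fst_of_differentiableAt hcomp.differentiableAt, hcomp.deriv,
        fderiv_eulerStep_apply hf]
      have hPs : P (c s) = (c s).2 + Ts * (-(1 / L * gradient f (c s).1)
        + forceNP f L κ (c s)) := rfl
      simp only [sub_apply, smul_apply,
        ContinuousLinearMap.coe_fst', smul_eq_mul, ← hP]
      linear_combination (deriv c s).1 * hPs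
    rw [intervalIntegral.integral_sub (j3.sub j1) (j2.const_mul Ts),
      intervalIntegral.integral_sub j3 j1, intervalIntegral.integral_const_mul] at hsum
    rw [hψ.signedArea_eq, hc.signedArea_eq, lineIntegralDq_real]
    change -(∫ s in (0 : ℝ)..1, P (c s) * deriv (fun t => ((eulerStep f L κ Ts ∘ c) t).1) s)
      - _ = _
    linarith
  · have h1 := (hPd.differentiable one_ne_zero (c s)).hasFDerivAt
    have h2 := (hgrad (c s).1).comp (c s) (hasFDerivAt_fst (𝕜 := ℝ) (F := ℝ))
    refine (((h1.pow 2).const_mul (Ts / 2)).sub (h2.const_mul (Ts / L))).congr_fderiv ?_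
    refine ContinuousLinearMap.ext fun v => ?_
    simp
    ring
  · have g1 : Continuous (gradient f) := (contDiff_gradient hf).continuous
    exact (((continuous_const.mul hPd.continuous).smul
      (hPd.continuous_fderiv one_ne_zero)).sub
      ((continuous_const.mul (g1.comp continuous_fst)).smul continuous_const)).continuousOn

/-! ### Green's theorem on the unit simplex -/

theorem isCompact_unitSimplex : IsCompact unitSimplex := by
  have hcl : IsClosed unitSimplex :=
    (isClosed_le continuous_const continuous_fst).inter
      ((isClosed_le continuous_const continuous_snd).inter
        (isClosed_le (continuous_fst.add continuous_snd) continuous_const))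
  refine (isCompact_Icc.prod isCompact_Icc :
    IsCompact (Icc (0 : ℝ) 1 ×ˢ Icc (0 : ℝ) 1)).of_isClosed_subset hcl ?_
  rintro ⟨x, y⟩ ⟨h1, h2, h3⟩
  simp only at h1 h2 h3
  exact ⟨⟨h1, by linarith⟩, h2, by linarith⟩

theorem setIntegral_unitSimplex {g : ℝ × ℝ → ℝ} (hg : Continuous g) :
    ∫ w in unitSimplex, g w = ∫ x in (0 : ℝ)..1, ∫ y in (0 : ℝ)..(1 - x), g (x, y) := by
  have hm := isCompact_unitSimplex.measurableSet
  have hi : Integrable (unitSimplex.indicator g) :=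
    (hg.continuousOn.integrableOn_compact isCompact_unitSimplex).integrable_indicator hm
  rw [← integral_indicator hm, Measure.volume_eq_prod, integral_prod _ hi,
    intervalIntegral.integral_of_le zero_le_one, ← integral_Icc_eq_integral_Ioc,
    ← integral_indicator measurableSet_Icc]
  congr 1
  funext x
  by_cases hx : x ∈ Icc (0 : ℝ) 1
  · rw [indicator_of_mem hx, intervalIntegral.integral_of_le (by linarith [hx.2]),
      ← integral_Icc_eq_integral_Ioc, ← integral_indicator measurableSet_Icc]
    congr 1
    funext y
    have : (x, y) ∈ unitSimplex ↔ y ∈ Icc 0 (1 - x) :=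
      ⟨fun h => ⟨h.2.1, le_sub_iff_add_le'.2 h.2.2⟩,
        fun h => ⟨hx.1, h.1, le_sub_iff_add_le'.1 h.2⟩⟩
    by_cases hy : y ∈ Icc 0 (1 - x)
    · rw [indicator_of_mem hy, indicator_of_mem (this.2 hy)]
    · rw [indicator_of_notMem hy, indicator_of_notMem (mt this.1 hy)]
  · rw [indicator_of_notMem hx]
    refine integral_eq_zero_of_ae (Filter.Eventually.of_forall fun y => indicator_of_notMem ?_ _)
    rintro ⟨h1, h2, h3⟩
    simp only at h1 h2 h3
    exact hx ⟨h1, by linarith⟩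

theorem setIntegral_unitSimplex_swap {g : ℝ × ℝ → ℝ} (hg : Continuous g) :
    ∫ w in unitSimplex, g w = ∫ y in (0 : ℝ)..1, ∫ x in (0 : ℝ)..(1 - y), g (x, y) := by
  have hpre : Prod.swap ⁻¹' unitSimplex = unitSimplex := by
    ext ⟨x, y⟩
    simp only [unitSimplex, mem_preimage, Prod.swap_prod_mk, mem_ofPred_eq]
    rw [add_comm y x]
    tauto
  have h := (Measure.measurePreserving_swap (μ := (volume : Measure ℝ))
    (ν := (volume : Measure ℝ))).setIntegral_preimage_emb
    MeasurableEquiv.prodComm.measurableEmbedding g unitSimplex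
  rw [hpre] at h
  rw [Measure.volume_eq_prod, ← h, ← Measure.volume_eq_prod]
  exact setIntegral_unitSimplex (hg.comp continuous_swap)

theorem integral_fderiv_snd {a : ℝ × ℝ → ℝ} (ha : ContDiff ℝ 1 a) (x r : ℝ) :
    ∫ y in (0 : ℝ)..r, fderiv ℝ a (x, y) (0, 1) = a (x, r) - a (x, 0) := by
  refine intervalIntegral.integral_eq_sub_of_hasDerivAt (f := fun y => a (x, y))
    (fun y _ => ?_) (Continuous.intervalIntegrable ?_ _ _)
  · exact (ha.differentiable one_ne_zero (x, y)).hasFDerivAt.comp_hasDerivAt y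
      ((hasDerivAt_const y x).prodMk (hasDerivAt_id y))
  · exact ((ha.continuous_fderiv one_ne_zero).comp (by fun_prop)).clm_apply continuous_const

theorem integral_fderiv_fst {b : ℝ × ℝ → ℝ} (hb : ContDiff ℝ 1 b) (y r : ℝ) :
    ∫ x in (0 : ℝ)..r, fderiv ℝ b (x, y) (1, 0) = b (r, y) - b (0, y) := by
  refine intervalIntegral.integral_eq_sub_of_hasDerivAt (f := fun x => b (x, y))
    (fun x _ => ?_) (Continuous.intervalIntegrable ?_ _ _)
  · exact (hb.differentiable one_ne_zero (x, y)).hasFDerivAt.comp_hasDerivAt x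
      ((hasDerivAt_id x).prodMk (hasDerivAt_const x y))
  · exact ((hb.continuous_fderiv one_ne_zero).comp (by fun_prop)).clm_apply continuous_const

/-- Green's formula for `a dx + b dy`: each derivative is integrated first along its own variable.
Reversing the parameter matches the remaining integrals with the orientation of the edges. -/
theorem setIntegral_unitSimplex_curl {a b : ℝ × ℝ → ℝ} (ha : ContDiff ℝ 1 a)
    (hb : ContDiff ℝ 1 b) :
    ∫ w in unitSimplex, (fderiv ℝ b w (1, 0) - fderiv ℝ a w (0, 1))
      = (∫ s in (0 : ℝ)..1, a (s, 0)) + (∫ s in (0 : ℝ)..1, (b (1 - s, s) - a (1 - s, s)))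
        - ∫ s in (0 : ℝ)..1, b (0, 1 - s) := by
  have ca : Continuous fun w => fderiv ℝ a w (0, 1) :=
    (ha.continuous_fderiv one_ne_zero).clm_apply continuous_const
  have cb : Continuous fun w => fderiv ℝ b w (1, 0) :=
    (hb.continuous_fderiv one_ne_zero).clm_apply continuous_const
  have hac := ha.continuous
  have hbc := hb.continuous
  rw [integral_sub (cb.continuousOn.integrableOn_compact isCompact_unitSimplex)
    (ca.continuousOn.integrableOn_compact isCompact_unitSimplex),
    setIntegral_unitSimplex ca, setIntegral_unitSimplex_swap cb]
  simp only [integral_fderiv_snd ha, integral_fderiv_fst hb]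
  have i1 : ∀ {φ : ℝ → ℝ}, Continuous φ → IntervalIntegrable φ volume 0 1 :=
    fun h => h.intervalIntegrable _ _
  rw [intervalIntegral.integral_sub (i1 (by fun_prop)) (i1 (by fun_prop)),
    intervalIntegral.integral_sub (i1 (by fun_prop)) (i1 (by fun_prop)),
    intervalIntegral.integral_sub (i1 (by fun_prop)) (i1 (by fun_prop))]
  have e1 : ∫ s in (0 : ℝ)..1, b (0, 1 - s) = ∫ s in (0 : ℝ)..1, b (0, s) := by
    simpa using intervalIntegral.integral_comp_sub_left (fun s => b (0, s)) (1 : ℝ)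
      (a := 0) (b := 1)
  have e2 : ∫ s in (0 : ℝ)..1, a (1 - s, s) = ∫ s in (0 : ℝ)..1, a (s, 1 - s) := by
    simpa using intervalIntegral.integral_comp_sub_left (fun s => a (s, 1 - s)) (1 : ℝ)
      (a := 0) (b := 1)
  rw [e1, e2]
  ring

/-! ### Stokes' theorem for surfaces in phase space -/

section Surface

variable {V : Type*} [NormedAddCommGroup V] [InnerProductSpace ℝ V]

theorem deriv_fst_comp {Φ : ℝ × ℝ → V × V} (hΦ : Differentiable ℝ Φ) {γ : ℝ → ℝ × ℝ}
    {v : ℝ × ℝ} {s : ℝ} (hγ : HasDerivAt γ v s) :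
    deriv (fun t => (Φ (γ t)).1) s = (fderiv ℝ Φ (γ s) v).1 :=
  ((ContinuousLinearMap.fst ℝ V V).hasFDerivAt.comp_hasDerivAt s
    ((hΦ (γ s)).hasFDerivAt.comp_hasDerivAt s hγ)).deriv

/-- Stokes for `F · dq`, by pulling it back to the simplex and taking the planar curl. The second
derivatives of `Φ` cancel by symmetry, which is where `C²` is used. -/
theorem boundaryIntegralDq_eq {F : V × V → V} (hF : ContDiff ℝ 1 F) {Φ : ℝ × ℝ → V × V}
    (hΦ : ContDiff ℝ 2 Φ) :
    boundaryIntegralDq F Φ = ∫ w in unitSimplex,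
      (inner ℝ (fderiv ℝ F (Φ w) (fderiv ℝ Φ w (1, 0))) (fderiv ℝ Φ w (0, 1)).1
        - inner ℝ (fderiv ℝ F (Φ w) (fderiv ℝ Φ w (0, 1))) (fderiv ℝ Φ w (1, 0)).1) := by
  have hd : Differentiable ℝ Φ := hΦ.differentiable two_ne_zero
  have hd2 : ContDiff ℝ 1 (fderiv ℝ Φ) := hΦ.fderiv_right (by norm_num)
  have hFΦ : ContDiff ℝ 1 (fun w => F (Φ w)) := hF.comp (hΦ.of_le one_le_two)
  set A : ℝ × ℝ → ℝ × ℝ → ℝ := fun e w => inner ℝ (F (Φ w)) (fderiv ℝ Φ w e).1 with hA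
  have hAc : ∀ e, ContDiff ℝ 1 (A e) := fun e =>
    hFΦ.inner ℝ (contDiff_fst.comp (hd2.clm_apply contDiff_const))
  have hAd : ∀ e v w, fderiv ℝ (A e) w v
      = inner ℝ (F (Φ w)) (fderiv ℝ (fderiv ℝ Φ) w v e).1
        + inner ℝ (fderiv ℝ F (Φ w) (fderiv ℝ Φ w v)) (fderiv ℝ Φ w e).1 := fun e v w => by
    have h1 := (hF.differentiable one_ne_zero (Φ w)).hasFDerivAt.comp w (hd w).hasFDerivAt
    have h2 : HasFDerivAt (fun w => (fderiv ℝ Φ w e).1) _ w :=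
      hasFDerivAt_fst.comp w ((ContinuousLinearMap.apply ℝ (V × V) e).hasFDerivAt.comp w
        (hd2.differentiable one_ne_zero w).hasFDerivAt)
    have h3 : HasFDerivAt (A e) _ w := h1.inner ℝ h2
    rw [h3.fderiv]
    rfl
  have hsymm : ∀ w, fderiv ℝ (fderiv ℝ Φ) w (1, 0) (0, 1) = fderiv ℝ (fderiv ℝ Φ) w (0, 1) (1, 0) :=
    fun w => hΦ.contDiffAt.isSymmSndFDerivAt (by simp) _ _
  have hcurl := setIntegral_unitSimplex_curl (hAc (1, 0)) (hAc (0, 1))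
  simp only [hAd, hsymm, add_sub_add_left_eq_sub] at hcurl
  rw [hcurl, boundaryIntegralDq, sub_eq_add_neg, ← intervalIntegral.integral_neg]
  have hsub : ∀ s : ℝ, HasDerivAt (fun t : ℝ => 1 - t) (-1) s := fun s =>
    (hasDerivAt_id' s).const_sub 1
  congr 1
  · congr 1
    · refine intervalIntegral.integral_congr fun s _ => ?_
      simp only [hA]
      rw [deriv_fst_comp hd ((hasDerivAt_id' s).prodMk (hasDerivAt_const s (0 : ℝ)))]
    · refine intervalIntegral.integral_congr fun s _ => ?_
      simp only [hA]
      rw [deriv_fst_comp hd ((hsub s).prodMk (hasDerivAt_id' s)),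
        -- The edge from `e₁` to `e₂` has velocity `e₂ - e₁`, which gives the difference `b - a`.
        show ((-1 : ℝ), (1 : ℝ)) = (0, 1) - (1, 0) by simp, map_sub, Prod.fst_sub,
        inner_sub_right]
  · refine intervalIntegral.integral_congr fun s _ => ?_
    simp only [hA]
    rw [deriv_fst_comp hd ((hasDerivAt_const s (0 : ℝ)).prodMk (hsub s)),
      show ((0 : ℝ), (-1 : ℝ)) = -(0, 1) by simp, map_neg, Prod.fst_neg, inner_neg_right]

theorem continuous_wedgeForm {M : V × V → V →L[ℝ] V} (hM : Continuous M) {Φ : ℝ × ℝ → V × V}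
    (hΦ : ContDiff ℝ 1 Φ) : Continuous fun w =>
      wedgeForm (M (Φ w)) (fderiv ℝ Φ w (1, 0)) (fderiv ℝ Φ w (0, 1)) := by
  have h : ∀ e, Continuous fun w => fderiv ℝ Φ w e := fun e =>
    (hΦ.continuous_fderiv one_ne_zero).clm_apply continuous_const
  have hMΦ := hM.comp hΦ.continuous
  unfold wedgeForm
  exact ((h _).fst.inner (hMΦ.clm_apply (h _).snd)).sub
    ((h _).fst.inner (hMΦ.clm_apply (h _).snd))

variable [CompleteSpace V]

theorem continuous_dampingMap {f : V → ℝ} (hf : ContDiff ℝ 2 f) (L κ : ℝ) :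
    Continuous (dampingMap f L κ) := by
  have h : Continuous (hessianMap f) := (contDiff_gradient hf).continuous_fderiv one_ne_zero
  unfold dampingMap
  have hq : Continuous fun x : V × V => x.1 + dampingBeta κ • x.2 := by fun_prop
  exact continuous_const.add ((h.comp hq).const_smul (dampingBeta κ / L))

theorem boundaryIntegralDq_forceNP {f : V → ℝ} (hf : ContDiff ℝ 2 f) (L κ : ℝ)
    {Φ : ℝ × ℝ → V × V} (hΦ : ContDiff ℝ 2 Φ) :
    boundaryIntegralDq (forceNP f L κ) Φ = surfaceIntegral (dampingMap f L κ) Φ := by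
  rw [boundaryIntegralDq_eq (contDiff_forceNP hf L κ) hΦ, surfaceIntegral]
  simp only [inner_fderiv_forceNP_sub hf]

/-- The pull-back identity is pointwise and involves first derivatives only, so `C¹` surfaces
suffice here. -/
theorem surfaceArea_eulerStep_comp {f : V → ℝ} (hf : ContDiff ℝ 2 f) (L κ Ts : ℝ)
    {Φ : ℝ × ℝ → V × V} (hΦ : ContDiff ℝ 1 Φ) :
    surfaceArea (eulerStep f L κ Ts ∘ Φ) - surfaceArea Φ
      = -Ts * surfaceIntegral (dampingMap f L κ) Φ := by
  have hchain : ∀ w e, fderiv ℝ (eulerStep f L κ Ts ∘ Φ) w e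
      = fderiv ℝ (eulerStep f L κ Ts) (Φ w) (fderiv ℝ Φ w e) := fun w e => by
    rw [fderiv_comp w ((contDiff_eulerStep hf L κ Ts).differentiable one_ne_zero _)
      (hΦ.differentiable one_ne_zero w)]
    rfl
  have i1 := (continuous_wedgeForm (M := fun _ => ContinuousLinearMap.id ℝ V) continuous_const
    hΦ).continuousOn.integrableOn_compact (μ := volume) isCompact_unitSimplex
  have i2 := (continuous_wedgeForm (continuous_dampingMap hf L κ)
    hΦ).continuousOn.integrableOn_compact (μ := volume) isCompact_unitSimplex
  simp only [surfaceArea, surfaceIntegral, hchain, wedgeForm_fderiv_eulerStep hf]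
  rw [integral_sub i1 (i2.const_mul Ts), integral_const_mul]
  ring

end Surface

end

theorem mainTheorem5 (L κ Ts : ℝ) (hL : 0 < L) (hκ : 1 ≤ κ) (hTs : 0 < Ts) :
    -- simple closed contours in the plane (`n = 1`)
    (∀ (f : ℝ → ℝ), ContDiff ℝ 2 f → ∀ (c : ℝ → ℝ × ℝ), IsSimpleClosedContour c →
      signedArea (eulerStep f L κ Ts ∘ c) - signedArea c
          = -Ts * lineIntegralDq (forceNP f L κ) c ∧
      -Ts * lineIntegralDq (forceNP f L κ) c
          = -Ts * signedIntegral c (fun z =>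
              2 * dampingD κ
                + dampingBeta κ / L * deriv (deriv f) (z.1 + dampingBeta κ * z.2))) ∧
    -- smooth two-dimensional surfaces with boundary in `ℝ²ⁿ`
    (∀ (n : ℕ) (f : EuclideanSpace ℝ (Fin n) → ℝ), ContDiff ℝ 2 f →
      ∀ (Φ : ℝ × ℝ → EuclideanSpace ℝ (Fin n) × EuclideanSpace ℝ (Fin n)), ContDiff ℝ 2 Φ →
      surfaceArea (eulerStep f L κ Ts ∘ Φ) - surfaceArea Φ
          = -Ts * boundaryIntegralDq (forceNP f L κ) Φ ∧
      -Ts * boundaryIntegralDq (forceNP f L κ) Φ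
          = -Ts * surfaceIntegral (dampingMap f L κ) Φ) := by
  refine ⟨fun f hf c hc => ?_, fun n f hf Φ hΦ => ?_⟩
  · have hloop := hc.isPiecewiseLoop
    exact ⟨hloop.signedArea_eulerStep_comp hf L κ Ts, by rw [hloop.lineIntegralDq_forceNP hf]⟩
  · rw [boundaryIntegralDq_forceNP hf L κ hΦ]
    exact ⟨surfaceArea_eulerStep_comp hf L κ Ts (hΦ.of_le one_le_two), rfl⟩
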